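/- Fix an integer $N\ge 1$. For $\mathbf n=(n_1,\dots,n_N)\in\mathbb{Z}^N$ put $|\mathbf n|=|n_1|+\cdots+|n_N|$. For $t>0$ let $$G_{t,N}(\mathbf n)=\prod_{i=1}^{N}e^{-2t}I_{n_i}(2t),\qquad W_tf(\mathbf n)=\sum_{\mathbf k\in\mathbb{Z}^N}G_{t,N}(\mathbf n-\mathbf k)f(\mathbf k)$$ be the heat kernel and the heat semigroup of the discrete Laplacian $\Delta_N$ on $\mathbb{Z}^N$, where $I_n$ is the modified Bessel function of the first kind of order $n$. For $0<2\sigma<N$ put $$(-\Delta_N)^{-\sigma}f(\mathbf n)=\frac1{\Gamma(\sigma)}\int_0^\infty W_tf(\mathbf n)\,t^{\sigma-1}\,dt,\qquad K_\sigma(\mathbf n)=\frac1{\Gamma(\sigma)}\int_0^\infty G_{t,N}(\mathbf n)\,t^{\sigma-1}\,dt .$$ **Theorem (extension of the Hardy–Littlewood–Sobolev inequality).** Let $0<2\sigma<N$ and $1\le q\le p\le\infty$ with $q<N/(N-1)$ (that is, $q<\infty$ if $N=1$) and $\frac1p<\frac1q-\frac{2\sigma-1}{N}$, where $1/\infty=0$.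 Then the integrals defining $K_\sigma$ converge absolutely, and there is a constant $C>0$, depending only on $N,\sigma,p,q$, such that for every real or complex sequence $f$ on $\mathbb{Z}^N$ with $|\cdot|f\in\ell^q(\mathbb{Z}^N)$ the sum $\sum_{\mathbf k}f(\mathbf k)$, the series defining $W_tf(\mathbf n)$ ($t>0$) and the integrals defining $(-\Delta_N)^{-\sigma}f(\mathbf n)$ converge absolutely, the sequence $(-\Delta_N)^{-\sigma}f-\big(\sum_{\mathbf k}f(\mathbf k)\big)K_\sigma$ belongs to $\ell^p(\mathbb{Z}^N)$, and $$\Big\|(-\Delta_N)^{-\sigma}f-\Big(\sum_{\mathbf k\in\mathbb{Z}^N}f(\mathbf k)\Big)K_\sigma\Big\|_{\ell^p(\mathbb{Z}^N)}\le C\,\big\||\cdot|f\big\|_{\ell^q(\mathbb{Z}^N)} .$$ -/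

import Mathlib

open scoped ENNReal

namespace DiscreteHeat

/-- The modified Bessel function of the first kind `I_n(x)`, of integer order `n`, by its power
series `∑ (x/2)^(2k+n) / (k! Γ(n+k+1))`. Mathlib's `Real.Gamma` is `0` at the poles of `Γ`, so for
negative `n` the terms with `n + k + 1 ≤ 0` vanish, which is the usual convention `1/Γ = 0` there. -/
noncomputable def besselI (n : ℤ) (x : ℝ) : ℝ :=
  ∑' k : ℕ, (x / 2) ^ (2 * (k : ℤ) + n) / ((k.factorial : ℝ) * Real.Gamma ((n : ℝ) + k + 1))

/-- The heat kernel `G_{t,N}(n) = ∏ e^{-2t} I_{n_i}(2t)` on `ℤ^N`. -/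
noncomputable def heatKernel {N : ℕ} (t : ℝ) (n : Fin N → ℤ) : ℝ :=
  ∏ i, Real.exp (-(2 * t)) * besselI (n i) (2 * t)

/-- The heat semigroup `W_t f(n) = ∑_k G_{t,N}(n - k) f(k)`. -/
noncomputable def heat {N : ℕ} {𝕜 : Type*} [RCLike 𝕜] (t : ℝ) (f : (Fin N → ℤ) → 𝕜)
    (n : Fin N → ℤ) : 𝕜 :=
  ∑' k : Fin N → ℤ, (heatKernel t (n - k) : 𝕜) * f k

/-- The fractional integral
`(-Δ_N)^{-σ} f(n) = Γ(σ)⁻¹ ∫_0^∞ W_t f(n) t^{σ-1} dt`. -/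
noncomputable def fracIntegral {N : ℕ} {𝕜 : Type*} [RCLike 𝕜] (σ : ℝ) (f : (Fin N → ℤ) → 𝕜)
    (n : Fin N → ℤ) : 𝕜 :=
  ((Real.Gamma σ)⁻¹ : ℝ) • ∫ t in Set.Ioi (0 : ℝ), (t ^ (σ - 1) : ℝ) • heat t f n

/-- The kernel `K_σ(n) = Γ(σ)⁻¹ ∫_0^∞ G_{t,N}(n) t^{σ-1} dt`. -/
noncomputable def fracKernel {N : ℕ} (σ : ℝ) (n : Fin N → ℤ) : ℝ :=
  (Real.Gamma σ)⁻¹ * ∫ t in Set.Ioi (0 : ℝ), t ^ (σ - 1) * heatKernel t n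

/-- The size `|n| = |n_1| + ⋯ + |n_N|` of a lattice point. -/
def size {N : ℕ} (n : Fin N → ℤ) : ℝ := ∑ i, |(n i : ℝ)|

/-- The weighted sequence `|·| f`. -/
def sizeMul {N : ℕ} {𝕜 : Type*} [RCLike 𝕜] (f : (Fin N → ℤ) → 𝕜) (n : Fin N → ℤ) : 𝕜 :=
  (size n : 𝕜) * f n

/-- The sequence `(-Δ_N)^{-σ} f - (∑_k f(k)) K_σ`. -/
noncomputable def fracDefect {N : ℕ} {𝕜 : Type*} [RCLike 𝕜] (σ : ℝ) (f : (Fin N → ℤ) → 𝕜)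
    (n : Fin N → ℤ) : 𝕜 :=
  fracIntegral σ f n - (∑' k : Fin N → ℤ, f k) * (fracKernel σ n : 𝕜)

end DiscreteHeat

/-! Since convolution with `K_σ` represents the fractional integral, the defect at `n` is `∑_k f(k)
(K_σ(n - k) - K_σ(n))`; the term `k = 0` drops out, so the weight `|k|` loses nothing by ignoring
`f(0)`. By Minkowski it suffices to find `θ` with `‖K_σ(· - k) - K_σ‖_p ≤ C |k|^θ` and `∑ |k|^θ
|f(k)| ≤ C ‖|·| f‖_q`.

The second bound is Hölder with the weight `|k|^(θ-1)`, which lies in the dual space when `θ < 1 -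
N(1 - 1/q)` (`exists_tsum_size_rpow_mul_norm_le`). The first comes from Minkowski in `t`
(`exists_lpLe_fracKernel_sub`) and the heat kernel estimate `‖G_t(· - k) - G_t‖_p ≤ C |k|^θ min(1,
t^(-β))`, `β = θ/2 + (N/2)(1 - 1/p)` (`LpLe.kernelDiff`); the time integral converges when `σ < β`.
The hypotheses on `p` and `q` say exactly that some `θ > 0` meets both constraints.

The heat kernel estimate interpolates between `ℓ^1` and `ℓ^∞`. It rests on elementary facts about
the one-dimensional kernel: it has mass at most `1`, decreases in `|n|`, has size `O(t^(-1/2))` and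
steps `O(1/t)`. The last two follow from the Bessel recurrence `profile_sub`. -/

namespace DiscreteHeat

open MeasureTheory

/-! ### The one-dimensional heat kernel: mass, monotonicity, size and steps. -/

/-- The term of the power series of `I_n(2t)`, for a natural number `n`. -/
noncomputable def besselTerm (t : ℝ) (n k : ℕ) : ℝ :=
  t ^ (2 * k + n) / ((k.factorial : ℝ) * ((k + n).factorial : ℝ))

lemma besselTerm_nonneg {t : ℝ} (ht : 0 ≤ t) (n k : ℕ) : 0 ≤ besselTerm t n k := by
  unfold besselTerm; positivity

lemma besselTerm_eq_mul (t : ℝ) (n k : ℕ) :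
    besselTerm t n k = t ^ k / (k.factorial : ℝ) * (t ^ (k + n) / ((k + n).factorial : ℝ)) := by
  unfold besselTerm
  rw [div_mul_div_comm, ← pow_add]
  congr 2; ring

lemma summable_prod_exp {t : ℝ} (ht : 0 ≤ t) :
    Summable fun x : ℕ × ℕ => t ^ x.1 / (x.1.factorial : ℝ) * (t ^ x.2 / (x.2.factorial : ℝ)) :=
  (Real.summable_pow_div_factorial t).mul_of_nonneg (Real.summable_pow_div_factorial t)
    (fun _ => by positivity) (fun _ => by positivity)

lemma tsum_prod_exp {t : ℝ} (ht : 0 ≤ t) :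
    ∑' x : ℕ × ℕ, t ^ x.1 / (x.1.factorial : ℝ) * (t ^ x.2 / (x.2.factorial : ℝ)) =
      Real.exp (2 * t) := by
  rw [← (Real.summable_pow_div_factorial t).tsum_mul_tsum
    (Real.summable_pow_div_factorial t) (summable_prod_exp ht)]
  have h : ∑' n : ℕ, t ^ n / (n.factorial : ℝ) = Real.exp t := by
    rw [Real.exp_eq_exp_ℝ, NormedSpace.exp_eq_tsum_div]
  rw [h, ← Real.exp_add]; congr 1; ring

/-- The pair `(a, b)` of natural numbers with difference `b - a = n` and minimum `k`, for the
index `(n, k)`. -/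
def diffPair (x : ℤ × ℕ) : ℕ × ℕ :=
  (x.2 + (-x.1).toNat, x.2 + x.1.toNat)

lemma diffPair_injective : Function.Injective diffPair := by
  rintro ⟨a, b⟩ ⟨c, d⟩ h
  simp only [diffPair, Prod.mk.injEq] at h
  ext <;> simp only <;> omega

lemma mul_diffPair (t : ℝ) (x : ℤ × ℕ) :
    t ^ (diffPair x).1 / ((diffPair x).1.factorial : ℝ) *
      (t ^ (diffPair x).2 / ((diffPair x).2.factorial : ℝ)) = besselTerm t x.1.natAbs x.2 := by
  rw [besselTerm_eq_mul]
  rcases le_total 0 x.1 with h | h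
  · have h1 : (-x.1).toNat = 0 := by omega
    have h2 : x.1.toNat = x.1.natAbs := by omega
    simp [diffPair, h1, h2]
  · have h1 : (-x.1).toNat = x.1.natAbs := by omega
    have h2 : x.1.toNat = 0 := by omega
    simp [diffPair, h1, h2, mul_comm]

lemma summable_besselTerm_prod {t : ℝ} (ht : 0 ≤ t) :
    Summable fun x : ℤ × ℕ => besselTerm t x.1.natAbs x.2 := by
  have := (summable_prod_exp ht).comp_injective diffPair_injective
  exact this.congr fun x => mul_diffPair t x

lemma summable_besselTerm {t : ℝ} (ht : 0 ≤ t) (n : ℕ) : Summable (besselTerm t n) :=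
  (summable_besselTerm_prod ht).prod_factor (n : ℤ)

/-- Expand `e^t · e^t` as a double series and group the pairs by difference and minimum: this is the
generating identity for `∑ I_n(2t)`. Only the inequality is needed, so injectivity of `diffPair`
suffices. -/
lemma tsum_besselTerm_prod_le {t : ℝ} (ht : 0 ≤ t) :
    ∑' x : ℤ × ℕ, besselTerm t x.1.natAbs x.2 ≤ Real.exp (2 * t) := by
  rw [← tsum_prod_exp ht]
  simp_rw [← mul_diffPair]
  exact tsum_comp_le_tsum_of_inj (summable_prod_exp ht) (fun x => by positivity)
    diffPair_injective

/-- The one-dimensional heat kernel at distance `n` from the origin. -/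
noncomputable def profile (t : ℝ) (n : ℕ) : ℝ :=
  Real.exp (-(2 * t)) * ∑' k, besselTerm t n k

lemma profile_nonneg {t : ℝ} (ht : 0 ≤ t) (n : ℕ) : 0 ≤ profile t n :=
  mul_nonneg (Real.exp_pos _).le (tsum_nonneg fun k => besselTerm_nonneg ht n k)

lemma summable_profile {t : ℝ} (ht : 0 ≤ t) : Summable fun n : ℤ => profile t n.natAbs :=
  (summable_besselTerm_prod ht).prod.mul_left _

lemma tsum_profile_le {t : ℝ} (ht : 0 ≤ t) : ∑' n : ℤ, profile t n.natAbs ≤ 1 := by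
  unfold profile
  rw [tsum_mul_left, ← (summable_besselTerm_prod ht).tsum_prod]
  calc _ ≤ Real.exp (-(2 * t)) * Real.exp (2 * t) :=
        mul_le_mul_of_nonneg_left (tsum_besselTerm_prod_le ht) (Real.exp_pos _).le
    _ = 1 := by rw [← Real.exp_add]; simp

/-- `I_{n+1} ≤ I_n` fails term by term when `t` is large, but by AM-GM each term of order `n + 1` is
at most the mean of two consecutive terms of order `n`. -/
lemma besselTerm_succ_le {t : ℝ} (ht : 0 ≤ t) (n k : ℕ) :
    besselTerm t (n + 1) k ≤ (besselTerm t n k + besselTerm t n (k + 1)) / 2 := by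
  have e1 : besselTerm t (n + 1) k = besselTerm t n k * (t * (k + 1) / ((k + 1) * (k + n + 1))) := by
    unfold besselTerm
    rw [← add_assoc k n 1, Nat.factorial_succ (k + n)]
    push_cast
    field_simp
    ring
  have e2 : besselTerm t n (k + 1) = besselTerm t n k * (t ^ 2 / ((k + 1) * (k + n + 1))) := by
    unfold besselTerm
    rw [show k + 1 + n = k + n + 1 by ring, Nat.factorial_succ (k + n), Nat.factorial_succ k]
    push_cast
    field_simp
    ring
  rw [e1, e2]
  have h0 := besselTerm_nonneg ht n k
  have h : t * (k + 1) / (((k : ℝ) + 1) * (k + n + 1)) ≤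
      (1 + t ^ 2 / ((k + 1) * (k + n + 1))) / 2 := by
    have hp : (0 : ℝ) < ((k : ℝ) + 1) * (k + n + 1) := by positivity
    rw [div_le_iff₀ hp]
    have : (1 + t ^ 2 / (((k : ℝ) + 1) * (k + n + 1))) / 2 * ((k + 1) * (k + n + 1)) =
        ((k + 1) * (k + n + 1) + t ^ 2) / 2 := by field_simp
    rw [this]
    have hn : (0 : ℝ) ≤ (k + 1) * n := by positivity
    nlinarith [sq_nonneg (t - (k + 1))]
  nlinarith [mul_le_mul_of_nonneg_left h h0]

lemma profile_succ_le {t : ℝ} (ht : 0 ≤ t) (n : ℕ) : profile t (n + 1) ≤ profile t n := by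
  refine mul_le_mul_of_nonneg_left ?_ (Real.exp_pos _).le
  have hs := summable_besselTerm ht n
  have hs' : Summable fun k => besselTerm t n (k + 1) := (summable_nat_add_iff 1).2 hs
  have h1 : ∑' k, besselTerm t (n + 1) k ≤
      ∑' k, (besselTerm t n k + besselTerm t n (k + 1)) / 2 :=
    (summable_besselTerm ht (n + 1)).tsum_le_tsum (besselTerm_succ_le ht n)
      ((hs.add hs').div_const 2)
  rw [tsum_div_const, hs.tsum_add hs'] at h1
  have h2 := hs.tsum_eq_zero_add
  have h3 := besselTerm_nonneg ht n 0
  linarith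

lemma profile_antitone {t : ℝ} (ht : 0 ≤ t) : Antitone (profile t) :=
  antitone_nat_of_succ_le (profile_succ_le ht)

/-- The classical recurrence `I_{ν-1}(x) - I_{ν+1}(x) = (2ν/x) I_ν(x)` at `ν = n + 1`, `x = 2t`. It
turns a bound on values into a bound on differences. -/
lemma profile_sub {t : ℝ} (ht : 0 < t) (n : ℕ) :
    profile t n - profile t (n + 2) = (n + 1) / t * profile t (n + 1) := by
  have h0 := summable_besselTerm ht.le n
  have h1 := summable_besselTerm ht.le (n + 1)
  have h2 := summable_besselTerm ht.le (n + 2)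
  have key : ∑' k, (besselTerm t n k - (n + 1) / t * besselTerm t (n + 1) k) =
      ∑' k, besselTerm t (n + 2) k := by
    have e : ∀ k, besselTerm t n (k + 1) - (n + 1) / t * besselTerm t (n + 1) (k + 1) =
        besselTerm t (n + 2) k := by
      intro k
      unfold besselTerm
      rw [show k + 1 + (n + 1) = k + n + 1 + 1 by ring, show k + (n + 2) = k + n + 1 + 1 by ring,
        show k + 1 + n = k + n + 1 by ring, Nat.factorial_succ (k + n + 1), Nat.factorial_succ k,
        show 2 * (k + 1) + (n + 1) = 2 * k + (n + 2) + 1 by ring,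
        show 2 * (k + 1) + n = 2 * k + (n + 2) by ring, pow_succ t (2 * k + (n + 2))]
      push_cast
      field_simp
      ring
    -- The terms of index `0` cancel, and the remaining ones match after a shift by one.
    have e0 : besselTerm t n 0 - (n + 1) / t * besselTerm t (n + 1) 0 = 0 := by
      unfold besselTerm
      rw [zero_add, zero_add, Nat.factorial_succ n, mul_zero, zero_add, zero_add, pow_succ]
      push_cast
      field_simp
      ring
    rw [(h0.sub (h1.mul_left _)).tsum_eq_zero_add, e0, zero_add]
    exact tsum_congr e
  rw [h0.tsum_sub (h1.mul_left _), tsum_mul_left] at key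
  unfold profile
  rw [← key]; ring

lemma sum_range_profile_le {t : ℝ} (ht : 0 ≤ t) (m : ℕ) :
    ∑ j ∈ Finset.range m, profile t j ≤ 1 := by
  have h := (summable_profile ht).sum_le_tsum
    ((Finset.range m).map ⟨((↑) : ℕ → ℤ), Nat.cast_injective⟩)
    (fun i _ => profile_nonneg ht _)
  rw [Finset.sum_map] at h
  simpa using h.trans (tsum_profile_le ht)

/-- By monotonicity the `m + 1` values at `0, …, m` are all at least the last one, and their sum is
at most `1`. -/
lemma succ_mul_profile_le {t : ℝ} (ht : 0 ≤ t) (m : ℕ) : (m + 1) * profile t m ≤ 1 := by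
  refine le_trans ?_ (sum_range_profile_le ht (m + 1))
  have := Finset.card_nsmul_le_sum (Finset.range (m + 1)) (profile t) (profile t m)
    (fun j hj => profile_antitone ht (by simpa [Nat.lt_succ_iff] using hj))
  simpa using this

lemma profile_sub_succ_le {t : ℝ} (ht : 0 < t) (n : ℕ) :
    profile t n - profile t (n + 1) ≤ 1 / t := by
  have h1 := profile_succ_le ht.le (n + 1)
  have h2 := profile_sub ht n
  have h3 : (n + 1) / t * profile t (n + 1) ≤ 1 / t := by
    rw [div_mul_eq_mul_div]
    refine div_le_div_of_nonneg_right ?_ ht.le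
    have := succ_mul_profile_le ht.le (n + 1)
    have := profile_nonneg ht.le (n + 1)
    push_cast at *
    nlinarith
  have h4 : profile t (n + 2) = profile t (n + 1 + 1) := rfl
  linarith

lemma profile_zero_sub_le {t : ℝ} (ht : 0 < t) (n : ℕ) :
    profile t 0 - profile t n ≤ n / t := by
  induction n with
  | zero => simp
  | succ n ih =>
    have := profile_sub_succ_le ht n
    push_cast
    rw [add_div]
    linarith

/-- At distance `m = ⌊√t⌋` the mass bound gives `1/(m + 1) ≤ 1/√t`; coming back to the origin in `m`
steps of size at most `1/t` costs at most another `1/√t`. -/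
lemma profile_zero_le {t : ℝ} (ht : 0 < t) : profile t 0 ≤ 2 / √t := by
  have hs : 0 < √t := Real.sqrt_pos.2 ht
  set m := ⌊√t⌋₊
  have h1 : (m : ℝ) ≤ √t := Nat.floor_le hs.le
  have h2 : √t ≤ m + 1 := (Nat.lt_floor_add_one _).le
  have h3 := succ_mul_profile_le ht.le m
  have h4 := profile_zero_sub_le ht m
  have h5 : profile t m ≤ 1 / √t := by
    rw [le_div_iff₀ hs]
    have := profile_nonneg ht.le m
    nlinarith
  have h6 : (m : ℝ) / t ≤ 1 / √t := by
    rw [div_le_div_iff₀ ht hs, one_mul]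
    calc (m : ℝ) * √t ≤ √t * √t := by gcongr
      _ = t := Real.mul_self_sqrt ht.le
  have : 2 / √t = 1 / √t + 1 / √t := by ring
  linarith

lemma exp_mul_besselI (t : ℝ) (n : ℤ) :
    Real.exp (-(2 * t)) * besselI n (2 * t) = profile t n.natAbs := by
  unfold profile besselI
  congr 1
  have e : (2 * t / 2) = t := by ring
  rw [e]
  rcases le_total 0 n with h | h
  · lift n to ℕ using h
    refine tsum_congr fun k => ?_
    unfold besselTerm
    rw [Int.natAbs_natCast]
    have : ((n : ℤ) : ℝ) + k + 1 = ((k + n : ℕ) : ℝ) + 1 := by push_cast; ring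
    rw [this, Real.Gamma_nat_eq_factorial]
    congr 1
  · obtain ⟨m, rfl⟩ : ∃ m : ℕ, n = -(m : ℤ) := ⟨n.natAbs, by omega⟩
    rw [Int.natAbs_neg, Int.natAbs_natCast]
    -- For order `-m` the terms with `k < m` vanish, because `Real.Gamma` is `0` at the poles; what
    -- remains is the series of order `m`, shifted by `m`.
    have hinj : Function.Injective fun j : ℕ => j + m := add_left_injective m
    rw [← hinj.tsum_eq]
    · refine tsum_congr fun k => ?_
      unfold besselTerm
      have : ((-(m : ℤ) : ℤ) : ℝ) + ((k + m : ℕ) : ℝ) + 1 = (k : ℝ) + 1 := by push_cast; ring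
      rw [this, Real.Gamma_nat_eq_factorial, mul_comm ((k + m).factorial : ℝ)]
      congr 1
      rw [← zpow_natCast]
      congr 1
      push_cast; ring
    · intro k hk
      by_contra hc
      apply hk
      have hlt : k < m := by
        by_contra hge
        exact hc ⟨k - m, by simp only; omega⟩
      have : ((-(m : ℤ) : ℤ) : ℝ) + (k : ℝ) + 1 = -((m - k - 1 : ℕ) : ℝ) := by
        have : m = (m - k - 1) + k + 1 := by omega
        conv_lhs => rw [this]
        push_cast; ring
      simp only
      rw [this, Real.Gamma_neg_nat_eq_zero, mul_zero, div_zero]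

/-! ### Bounds on `ℓ^p` norms: interpolation and Minkowski's inequality. -/

/-- The `ℓ^p` norm of the family `h` of extended nonnegative numbers is at most `B`. -/
def LpLe {ι : Type*} (p : ℝ≥0∞) (h : ι → ℝ≥0∞) (B : ℝ≥0∞) : Prop :=
  if p = ∞ then ∀ n, h n ≤ B else ∑' n, h n ^ p.toReal ≤ B ^ p.toReal

lemma LpLe.mono {ι : Type*} {p : ℝ≥0∞} {h h' : ι → ℝ≥0∞} {B B' : ℝ≥0∞} (H : LpLe p h B)
    (hh : ∀ n, h' n ≤ h n) (hB : B ≤ B') : LpLe p h' B' := by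
  unfold LpLe at *
  split_ifs at * with hp
  · exact fun n => (hh n).trans ((H n).trans hB)
  · refine le_trans (ENNReal.tsum_le_tsum fun n => ?_) (H.trans ?_)
    · exact ENNReal.rpow_le_rpow (hh n) ENNReal.toReal_nonneg
    · exact ENNReal.rpow_le_rpow hB ENNReal.toReal_nonneg

lemma one_le_toReal {p : ℝ≥0∞} (hp : 1 ≤ p) (hp' : p ≠ ∞) : 1 ≤ p.toReal := by
  simpa using ENNReal.toReal_mono hp' hp

/-- Interpolation between `ℓ^1` and `ℓ^∞`: `∑ h^r ≤ (sup h)^(r-1) ∑ h`. In the application to large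
times `M` is `t^(-N/2)`, the gain of the supremum over the sum. -/
lemma LpLe.of_tsum_le_of_le {ι : Type*} {p : ℝ≥0∞} (hp : 1 ≤ p) {h : ι → ℝ≥0∞} {X M : ℝ≥0∞}
    (h1 : ∑' n, h n ≤ X) (h2 : ∀ n, h n ≤ X * M) :
    LpLe p h (X * M ^ (1 - (1 / p).toReal)) := by
  unfold LpLe
  split_ifs with hp'
  · subst hp'
    simpa using h2
  · have hr := one_le_toReal hp hp'
    have hr0 : (0 : ℝ) ≤ p.toReal := by linarith
    rw [one_div, ENNReal.toReal_inv]
    set r := p.toReal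
    calc ∑' n, h n ^ r ≤ ∑' n, (X * M) ^ (r - 1) * h n := by
          refine ENNReal.tsum_le_tsum fun n => ?_
          calc h n ^ r = h n ^ (r - 1) * h n := by
                conv_lhs => rw [show r = (r - 1) + 1 by ring]
                rw [ENNReal.rpow_add_of_nonneg _ _ (by linarith) zero_le_one, ENNReal.rpow_one]
            _ ≤ _ := by
                exact mul_le_mul_left (ENNReal.rpow_le_rpow (h2 n) (by linarith)) _
      _ ≤ (X * M) ^ (r - 1) * X := by
          rw [ENNReal.tsum_mul_left]
          gcongr
      _ = (X * M ^ (1 - r⁻¹)) ^ r := by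
          rw [ENNReal.mul_rpow_of_nonneg _ _ hr0, ENNReal.mul_rpow_of_nonneg _ _ (by linarith),
            ← ENNReal.rpow_mul, show (1 - r⁻¹) * r = r - 1 by field_simp]
          conv_rhs => rw [show X ^ r = X ^ (r - 1 + 1) by ring_nf]
          rw [ENNReal.rpow_add_of_nonneg _ _ (by linarith) zero_le_one, ENNReal.rpow_one]
          ring

/-- Hölder for the splitting `F = (F A^(-1/s)) · A^(1/s)`, with `s` conjugate to `r`. The weight `A`
will not depend on the index of the family, so this bound can be summed over it. -/
lemma lintegral_rpow_le {Y : Type*} [MeasurableSpace Y] (μ : Measure Y) {r : ℝ} (hr : 1 ≤ r)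
    {F A : Y → ℝ≥0∞} (hF : Measurable F) (hA : Measurable A) (hA' : ∀ y, A y ≠ ∞)
    (hFA : ∀ y, A y = 0 → F y = 0) :
    (∫⁻ y, F y ∂μ) ^ r ≤
      (∫⁻ y, A y ∂μ) ^ (r - 1) * ∫⁻ y, F y ^ r * A y ^ (1 - r) ∂μ := by
  rcases hr.eq_or_lt with rfl | hr
  · simp
  have hr0 : 0 < r := by linarith
  have hc := Real.HolderConjugate.conjExponent hr
  set s := r.conjExponent
  have hs : 1 / s = 1 - 1 / r := by
    have := hc.inv_add_inv_eq_one
    rw [one_div, one_div]; linarith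
  have hs0 : s ≠ 0 := hc.symm.ne_zero
  have h1 : ∫⁻ y, F y ∂μ ≤ (∫⁻ y, F y ^ r * A y ^ (1 - r) ∂μ) ^ (1 / r) *
      (∫⁻ y, A y ∂μ) ^ (1 / s) := by
    have H := ENNReal.lintegral_mul_le_Lp_mul_Lq μ hc
      (f := fun y => F y * A y ^ (-(1 / s))) (g := fun y => A y ^ (1 / s))
      (hF.mul (hA.pow_const _)).aemeasurable (hA.pow_const _).aemeasurable
    refine le_trans (le_of_eq ?_) (H.trans (le_of_eq ?_))
    · refine lintegral_congr fun y => ?_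
      simp only [Pi.mul_apply]
      by_cases hy : A y = 0
      · simp [hFA y hy]
      · rw [mul_assoc, ← ENNReal.rpow_add _ _ hy (hA' y)]
        simp
    · congr 2
      · refine lintegral_congr fun y => ?_
        rw [ENNReal.mul_rpow_of_nonneg _ _ hr0.le, ← ENNReal.rpow_mul]
        congr 2
        rw [hs]; field_simp; ring
      · refine lintegral_congr fun y => ?_
        rw [← ENNReal.rpow_mul, one_div_mul_cancel hs0, ENNReal.rpow_one]
  refine (ENNReal.rpow_le_rpow h1 hr0.le).trans (le_of_eq ?_)
  rw [ENNReal.mul_rpow_of_nonneg _ _ hr0.le, ← ENNReal.rpow_mul, ← ENNReal.rpow_mul,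
    one_div_mul_cancel hr0.ne', ENNReal.rpow_one, mul_comm, hs]
  congr 2
  field_simp

/-- **Minkowski's integral inequality** for `ℓ^p` norms. -/
lemma LpLe.lintegral {ι Y : Type*} [Countable ι] [MeasurableSpace Y] (μ : Measure Y) {p : ℝ≥0∞}
    (hp : 1 ≤ p) {F : ι → Y → ℝ≥0∞} {A : Y → ℝ≥0∞} (hF : ∀ n, Measurable (F n))
    (hA : Measurable A) (hA' : ∀ y, A y ≠ ∞) (H : ∀ y, LpLe p (fun n => F n y) (A y)) :
    LpLe p (fun n => ∫⁻ y, F n y ∂μ) (∫⁻ y, A y ∂μ) := by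
  unfold LpLe at *
  split_ifs at * with hp'
  · exact fun n => lintegral_mono fun y => H y n
  · have hr := one_le_toReal hp hp'
    set r := p.toReal
    have hr0 : 0 < r := by linarith
    have hFA : ∀ n y, A y = 0 → F n y = 0 := by
      intro n y hy
      have := (ENNReal.le_tsum n).trans (H y)
      rw [hy, ENNReal.zero_rpow_of_pos hr0] at this
      exact (ENNReal.rpow_eq_zero_iff_of_pos hr0).1 (le_antisymm this zero_le)
    -- After weighted Hölder for each `n`, Tonelli brings the sum inside, where `(∑ F^r) A^(1-r) ≤
    -- A`.
    calc ∑' n, (∫⁻ y, F n y ∂μ) ^ r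
        ≤ ∑' n, (∫⁻ y, A y ∂μ) ^ (r - 1) * ∫⁻ y, F n y ^ r * A y ^ (1 - r) ∂μ :=
          ENNReal.tsum_le_tsum fun n => lintegral_rpow_le μ hr (hF n) hA hA' (hFA n)
      _ = (∫⁻ y, A y ∂μ) ^ (r - 1) * ∫⁻ y, (∑' n, F n y ^ r) * A y ^ (1 - r) ∂μ := by
          simp_rw [ENNReal.tsum_mul_left, ← ENNReal.tsum_mul_right]
          rw [lintegral_tsum fun n => by
            exact (((hF n).pow_const _).mul (hA.pow_const _)).aemeasurable]
      _ ≤ (∫⁻ y, A y ∂μ) ^ (r - 1) * ∫⁻ y, A y ∂μ := by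
          gcongr with y
          by_cases hy : A y = 0
          · simp [hFA _ y hy, hr0]
          · calc (∑' n, F n y ^ r) * A y ^ (1 - r) ≤ A y ^ r * A y ^ (1 - r) := by
                  gcongr; exact H y
              _ = A y := by
                  rw [← ENNReal.rpow_add _ _ hy (hA' y)]; simp
      _ = (∫⁻ y, A y ∂μ) ^ r := by
          conv_rhs => rw [show r = (r - 1) + 1 by ring]
          rw [ENNReal.rpow_add_of_nonneg _ _ (by linarith) zero_le_one, ENNReal.rpow_one]

/-- Minkowski's inequality for series. -/
lemma LpLe.tsum {ι κ : Type*} [Countable ι] {p : ℝ≥0∞}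
    (hp : 1 ≤ p) {F : ι → κ → ℝ≥0∞} {A : κ → ℝ≥0∞} (hA' : ∀ y, A y ≠ ∞)
    (H : ∀ y, LpLe p (fun n => F n y) (A y)) :
    LpLe p (fun n => ∑' y, F n y) (∑' y, A y) := by
  let _ : MeasurableSpace κ := ⊤
  have := LpLe.lintegral (Measure.count : Measure κ) hp (fun n => measurable_from_top)
    measurable_from_top hA' H
  simpa [lintegral_count' measurable_from_top] using this

lemma LpLe.exists_norm_le {ι E : Type*} [NormedAddCommGroup E] {p : ℝ≥0∞} (hp : 1 ≤ p)
    {f : ι → E} {B : ℝ} (hB : 0 ≤ B) (H : LpLe p (fun n => ‖f n‖ₑ) (ENNReal.ofReal B)) :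
    ∃ h : Memℓp f p, ‖(⟨f, h⟩ : lp (fun _ : ι => E) p)‖ ≤ B := by
  unfold LpLe at H
  split_ifs at H with hp'
  · subst hp'
    have H' : ∀ n, ‖f n‖ ≤ B := fun n => by
      have : ‖f n‖ₑ ≤ ENNReal.ofReal B := H n
      rwa [← ofReal_norm, ENNReal.ofReal_le_ofReal_iff hB] at this
    refine ⟨memℓp_infty ⟨B, by rintro - ⟨n, rfl⟩; exact H' n⟩, ?_⟩
    exact lp.norm_le_of_forall_le hB H'
  · have hr := one_le_toReal hp hp'
    have hr0 : 0 < p.toReal := by linarith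
    have H' : ∀ s : Finset ι, ∑ i ∈ s, ‖f i‖ ^ p.toReal ≤ B ^ p.toReal := fun s => by
      have := (ENNReal.sum_le_tsum s).trans H
      rw [ENNReal.ofReal_rpow_of_nonneg hB hr0.le] at this
      rw [← ENNReal.ofReal_le_ofReal_iff (by positivity),
        ENNReal.ofReal_sum_of_nonneg fun i _ => by positivity]
      refine le_trans (le_of_eq (Finset.sum_congr rfl fun i _ => ?_)) this
      simp only
      rw [← ofReal_norm, ENNReal.ofReal_rpow_of_nonneg (norm_nonneg _) hr0.le]
    exact ⟨memℓp_gen' H', lp.norm_le_of_forall_sum_le hr0 hB H'⟩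

/-! ### Translates of the one-dimensional kernel, in `ℓ^1` and in supremum. -/

lemma tsum_ofReal_profile_le {t : ℝ} (ht : 0 ≤ t) (k : ℤ) :
    ∑' m : ℤ, ENNReal.ofReal (profile t (m - k).natAbs) ≤ 1 := by
  refine (le_of_eq ((Equiv.subRight k).tsum_eq
    fun m : ℤ => ENNReal.ofReal (profile t m.natAbs))).trans ?_
  rw [← ENNReal.ofReal_tsum_of_nonneg (fun m => profile_nonneg ht _) (summable_profile ht)]
  simpa using tsum_profile_le ht

lemma tsum_ofReal_profile_sub_succ_le {t : ℝ} (ht : 0 ≤ t) :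
    ∑' n : ℕ, ENNReal.ofReal (profile t n - profile t (n + 1)) ≤ ENNReal.ofReal (profile t 0) := by
  refine ENNReal.tsum_le_of_sum_range_le fun n => ?_
  rw [← ENNReal.ofReal_sum_of_nonneg fun i _ => sub_nonneg.2 (profile_succ_le ht i),
    Finset.sum_range_sub']
  exact ENNReal.ofReal_le_ofReal (by linarith [profile_nonneg ht n])

/-- The kernel is even and unimodal, so its variation telescopes to at most `profile t 0` on each
half-line. -/
lemma tsum_ofReal_abs_step_le {t : ℝ} (ht : 0 ≤ t) :
    ∑' m : ℤ, ENNReal.ofReal |profile t (m + 1).natAbs - profile t m.natAbs| ≤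
      ENNReal.ofReal (2 * profile t 0) := by
  have h0 : ∀ n : ℕ, profile t n - profile t (n + 1) = |profile t (n + 1) - profile t n| :=
    fun n => by
      rw [abs_of_nonpos (by linarith [profile_succ_le ht n])]; ring
  have h1 : ∀ n : ℕ, ENNReal.ofReal
      |profile t ((n : ℤ) + 1).natAbs - profile t (n : ℤ).natAbs| =
      ENNReal.ofReal (profile t n - profile t (n + 1)) := fun n => by
    rw [h0]; congr 3
  have h2 : ∀ n : ℕ, ENNReal.ofReal
      |profile t (-((n : ℤ) + 1) + 1).natAbs - profile t (-((n : ℤ) + 1)).natAbs| =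
      ENNReal.ofReal (profile t n - profile t (n + 1)) := fun n => by
    rw [h0, abs_sub_comm, show (-((n : ℤ) + 1) + 1).natAbs = n by omega,
      show (-((n : ℤ) + 1)).natAbs = n + 1 by omega]
  rw [tsum_of_nat_of_neg_add_one ENNReal.summable ENNReal.summable]
  simp_rw [h1, h2]
  rw [two_mul, ENNReal.ofReal_add (profile_nonneg ht 0) (profile_nonneg ht 0)]
  exact add_le_add (tsum_ofReal_profile_sub_succ_le ht) (tsum_ofReal_profile_sub_succ_le ht)

lemma tsum_ofReal_abs_shift_nat_le {t : ℝ} (ht : 0 ≤ t) (k : ℕ) :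
    ∑' m : ℤ, ENNReal.ofReal |profile t (m + k).natAbs - profile t m.natAbs| ≤
      k * ENNReal.ofReal (2 * profile t 0) := by
  induction k with
  | zero => simp
  | succ k ih =>
    calc _ ≤ ∑' m : ℤ, (ENNReal.ofReal |profile t (m + k + 1).natAbs - profile t (m + k).natAbs| +
          ENNReal.ofReal |profile t (m + k).natAbs - profile t m.natAbs|) := by
          refine ENNReal.tsum_le_tsum fun m => ?_
          rw [← ENNReal.ofReal_add (abs_nonneg _) (abs_nonneg _)]
          refine ENNReal.ofReal_le_ofReal ?_
          push_cast
          rw [← add_assoc]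
          exact abs_sub_le _ _ _
      _ ≤ ENNReal.ofReal (2 * profile t 0) + k * ENNReal.ofReal (2 * profile t 0) := by
          rw [ENNReal.tsum_add]
          refine add_le_add ?_ ih
          refine (le_of_eq ((Equiv.addRight (k : ℤ)).tsum_eq fun m : ℤ =>
            ENNReal.ofReal |profile t (m + 1).natAbs - profile t m.natAbs|)).trans ?_
          exact tsum_ofReal_abs_step_le ht
      _ = _ := by push_cast; ring

lemma tsum_ofReal_abs_shift_le {t : ℝ} (ht : 0 ≤ t) (k : ℤ) :
    ∑' m : ℤ, ENNReal.ofReal |profile t (m - k).natAbs - profile t m.natAbs| ≤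
      ENNReal.ofReal (|(k : ℝ)| * (2 * profile t 0)) := by
  have hk : ENNReal.ofReal (|(k : ℝ)| * (2 * profile t 0)) =
      (k.natAbs : ℕ) * ENNReal.ofReal (2 * profile t 0) := by
    rw [ENNReal.ofReal_mul (abs_nonneg _), ← Int.cast_abs, Int.abs_eq_natAbs, Int.cast_natCast,
      ENNReal.ofReal_natCast]
  rw [hk]
  refine le_trans (le_of_eq ?_) (tsum_ofReal_abs_shift_nat_le ht k.natAbs)
  rcases le_total k 0 with h | h
  · refine tsum_congr fun m => ?_
    rw [show m - k = m + k.natAbs by omega]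
  · rw [← (Equiv.subRight k).tsum_eq fun m : ℤ =>
      ENNReal.ofReal |profile t (m + k.natAbs).natAbs - profile t m.natAbs|]
    refine tsum_congr fun m => ?_
    simp only [Equiv.subRight_apply]
    rw [show m - k + k.natAbs = m by omega, abs_sub_comm]

lemma abs_step_le {t : ℝ} (ht : 0 < t) (m : ℤ) :
    |profile t (m + 1).natAbs - profile t m.natAbs| ≤ 1 / t := by
  rcases le_or_gt 0 m with h | h
  · rw [show (m + 1).natAbs = m.natAbs + 1 by omega, abs_sub_comm, abs_of_nonneg]
    · exact profile_sub_succ_le ht _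
    · linarith [profile_succ_le ht.le m.natAbs]
  · rw [show m.natAbs = (m + 1).natAbs + 1 by omega, abs_of_nonneg]
    · exact profile_sub_succ_le ht _
    · linarith [profile_succ_le ht.le (m + 1).natAbs]

lemma abs_shift_nat_le {t : ℝ} (ht : 0 < t) (k : ℕ) (m : ℤ) :
    |profile t (m + k).natAbs - profile t m.natAbs| ≤ k / t := by
  induction k with
  | zero => simp
  | succ k ih =>
    have h1 := abs_step_le ht (m + k)
    have h2 := abs_sub_le (profile t (m + k + 1).natAbs) (profile t (m + k).natAbs)
      (profile t m.natAbs)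
    push_cast
    rw [← add_assoc, add_div]
    linarith

lemma abs_shift_le {t : ℝ} (ht : 0 < t) (k m : ℤ) :
    |profile t (m - k).natAbs - profile t m.natAbs| ≤ |(k : ℝ)| / t := by
  have hk : |(k : ℝ)| = (k.natAbs : ℕ) := by
    rw [← Int.cast_abs, Int.abs_eq_natAbs, Int.cast_natCast]
  rw [hk]
  rcases le_total k 0 with h | h
  · rw [show m - k = m + k.natAbs by omega]
    exact abs_shift_nat_le ht _ _
  · have := abs_shift_nat_le ht k.natAbs (m - k)
    rwa [show m - k + k.natAbs = m by omega, abs_sub_comm] at this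

lemma profile_le {t : ℝ} (ht : 0 < t) (n : ℕ) : profile t n ≤ 2 / √t :=
  (profile_antitone ht.le (Nat.zero_le n)).trans (profile_zero_le ht)

lemma profile_le_one {t : ℝ} (ht : 0 ≤ t) (n : ℕ) : profile t n ≤ 1 :=
  (profile_antitone ht (Nat.zero_le n)).trans (by simpa using succ_mul_profile_le ht 0)

/-! ### The heat kernel on `ℤ^N` and its translation differences. -/

lemma heatKernel_eq {N : ℕ} (t : ℝ) (n : Fin N → ℤ) :
    heatKernel t n = ∏ i, profile t (n i).natAbs :=
  Finset.prod_congr rfl fun i _ => exp_mul_besselI t (n i)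

lemma heatKernel_nonneg {N : ℕ} {t : ℝ} (ht : 0 ≤ t) (n : Fin N → ℤ) : 0 ≤ heatKernel t n := by
  rw [heatKernel_eq]
  exact Finset.prod_nonneg fun i _ => profile_nonneg ht _

lemma heatKernel_le_one {N : ℕ} {t : ℝ} (ht : 0 ≤ t) (n : Fin N → ℤ) : heatKernel t n ≤ 1 := by
  rw [heatKernel_eq]
  exact Finset.prod_le_one (fun i _ => profile_nonneg ht _) fun i _ => profile_le_one ht _

lemma heatKernel_le {N : ℕ} {t : ℝ} (ht : 0 < t) (n : Fin N → ℤ) :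
    heatKernel t n ≤ (2 / √t) ^ N := by
  rw [heatKernel_eq]
  refine (Finset.prod_le_prod (fun i _ => profile_nonneg ht.le _)
    fun i _ => profile_le ht _).trans ?_
  rw [Finset.prod_const, Finset.card_univ, Fintype.card_fin]

/-- Every finite set of lattice points lies in a box, over which the sum of products factors. -/
lemma tsum_prod_le_prod_tsum {ι : Type*} [Fintype ι] (c : ι → ℤ → ℝ≥0∞) :
    ∑' n : ι → ℤ, ∏ i, c i (n i) ≤ ∏ i, ∑' m, c i m := by
  classical
  rw [ENNReal.tsum_eq_iSup_sum]
  refine iSup_le fun s => ?_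
  calc ∑ n ∈ s, ∏ i, c i (n i)
      ≤ ∑ n ∈ Fintype.piFinset fun i => s.image fun n => n i, ∏ i, c i (n i) := by
        refine Finset.sum_le_sum_of_subset fun n hn => ?_
        rw [Fintype.mem_piFinset]
        exact fun i => Finset.mem_image_of_mem (fun n : ι → ℤ => n i) hn
    _ = ∏ i, ∑ m ∈ s.image fun n => n i, c i m := (Finset.prod_univ_sum _ _).symm
    _ ≤ ∏ i, ∑' m, c i m := Finset.prod_le_prod' fun i _ => ENNReal.sum_le_tsum _

lemma tsum_ofReal_heatKernel_le {N : ℕ} {t : ℝ} (ht : 0 ≤ t) (k : Fin N → ℤ) :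
    ∑' n : Fin N → ℤ, ENNReal.ofReal (heatKernel t (n - k)) ≤ 1 := by
  have h : ∀ n : Fin N → ℤ, ENNReal.ofReal (heatKernel t (n - k)) =
      ∏ i, ENNReal.ofReal (profile t (n i - k i).natAbs) := fun n => by
    rw [heatKernel_eq, ENNReal.ofReal_prod_of_nonneg fun i _ => profile_nonneg ht _]
    rfl
  simp_rw [h]
  exact (tsum_prod_le_prod_tsum fun i m => ENNReal.ofReal (profile t (m - k i).natAbs)).trans
    (Finset.prod_le_one' fun i _ => tsum_ofReal_profile_le ht _)

/-- Telescoping replaces one factor at a time. Relaxing the other factors, `a j` or `b j`, to `a j +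
b j` makes the bound independent of the order of the coordinates. -/
lemma abs_prod_sub_prod_le {ι : Type*} [DecidableEq ι] (s : Finset ι) {a b : ι → ℝ}
    (ha : ∀ i, 0 ≤ a i) (hb : ∀ i, 0 ≤ b i) :
    |∏ i ∈ s, a i - ∏ i ∈ s, b i| ≤
      ∑ i ∈ s, ∏ j ∈ s, if j = i then |a j - b j| else a j + b j := by
  induction s using Finset.induction_on with
  | empty => simp
  | insert x s hx ih =>
    rw [Finset.prod_insert hx, Finset.prod_insert hx, Finset.sum_insert hx, Finset.prod_insert hx]
    have e1 : ∏ j ∈ s, (if j = x then |a j - b j| else a j + b j) = ∏ j ∈ s, (a j + b j) :=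
      Finset.prod_congr rfl fun j hj => if_neg (by rintro rfl; exact hx hj)
    have e2 : ∑ i ∈ s, ∏ j ∈ insert x s, (if j = i then |a j - b j| else a j + b j) =
        (a x + b x) * ∑ i ∈ s, ∏ j ∈ s, if j = i then |a j - b j| else a j + b j := by
      rw [Finset.mul_sum]
      refine Finset.sum_congr rfl fun i hi => ?_
      rw [Finset.prod_insert hx, if_neg (by rintro rfl; exact hx hi)]
    rw [e1, e2, if_pos rfl]
    have h1 : ∏ i ∈ s, a i ≤ ∏ i ∈ s, (a i + b i) :=
      Finset.prod_le_prod (fun i _ => ha i) fun i _ => by linarith [hb i]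
    have e3 : a x * ∏ i ∈ s, a i - b x * ∏ i ∈ s, b i =
        (a x - b x) * ∏ i ∈ s, a i + b x * (∏ i ∈ s, a i - ∏ i ∈ s, b i) := by ring
    rw [e3]
    refine (abs_add_le _ _).trans (add_le_add ?_ ?_)
    · rw [abs_mul, abs_of_nonneg (Finset.prod_nonneg fun i _ => ha i)]
      gcongr
    · rw [abs_mul, abs_of_nonneg (hb x)]
      refine mul_le_mul (by linarith [ha x]) ih (abs_nonneg _) (add_nonneg (ha x) (hb x))

lemma prod_ite_eq_mul_pow {M : Type*} [CommMonoid M] {N : ℕ} (i : Fin N) (x y : M) :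
    ∏ j : Fin N, (if j = i then x else y) = x * y ^ (N - 1) := by
  rw [← Finset.mul_prod_erase _ _ (Finset.mem_univ i), if_pos rfl,
    Finset.prod_congr rfl fun j hj => if_neg (Finset.ne_of_mem_erase hj)]
  simp

/-- The difference `G_t(n - k) - G_t(n)`. -/
noncomputable def kernelDiff {N : ℕ} (k : Fin N → ℤ) (t : ℝ) (n : Fin N → ℤ) : ℝ :=
  heatKernel t (n - k) - heatKernel t n

lemma size_nonneg {N : ℕ} (k : Fin N → ℤ) : 0 ≤ size k :=
  Finset.sum_nonneg fun _ _ => abs_nonneg _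

lemma abs_kernelDiff_le_sum {N : ℕ} {t : ℝ} (ht : 0 ≤ t) (k n : Fin N → ℤ) :
    |kernelDiff k t n| ≤ ∑ i, ∏ j, if j = i
      then |profile t (n j - k j).natAbs - profile t (n j).natAbs|
      else profile t (n j - k j).natAbs + profile t (n j).natAbs := by
  unfold kernelDiff
  rw [heatKernel_eq, heatKernel_eq]
  exact abs_prod_sub_prod_le _ (fun _ => profile_nonneg ht _) fun _ => profile_nonneg ht _

/-- In each telescoped term one coordinate contributes a difference, at most `|k i| / t`, and the
others at most `4/√t`: a gain of `|k|/√t` over the size `t^(-N/2)`. -/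
lemma abs_kernelDiff_le {N : ℕ} {t : ℝ} (ht : 0 < t) (k n : Fin N → ℤ) :
    |kernelDiff k t n| ≤ 4 ^ N * (size k / √t) * (1 / √t) ^ N := by
  have hs : 0 < √t := Real.sqrt_pos.2 ht
  have h1 : ∀ i : Fin N, (∏ j, if j = i
      then |profile t (n j - k j).natAbs - profile t (n j).natAbs|
      else profile t (n j - k j).natAbs + profile t (n j).natAbs) ≤
      |(k i : ℝ)| * (4 ^ N * (1 / √t) * (1 / √t) ^ N) := fun i => by
    calc _ ≤ ∏ j, if j = i then |(k i : ℝ)| / t else 4 / √t := by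
          refine Finset.prod_le_prod (fun j _ => ?_) fun j _ => ?_
          · split_ifs
            · exact abs_nonneg _
            · exact add_nonneg (profile_nonneg ht.le _) (profile_nonneg ht.le _)
          · split_ifs with h
            · subst h; exact abs_shift_le ht _ _
            · have e1 := profile_le ht (n j - k j).natAbs
              have e2 := profile_le ht (n j).natAbs
              calc _ ≤ 2 / √t + 2 / √t := add_le_add e1 e2
                _ = 4 / √t := by ring
      _ = |(k i : ℝ)| / t * (4 / √t) ^ (N - 1) := prod_ite_eq_mul_pow i _ _
      _ ≤ |(k i : ℝ)| / t * (4 * (4 / √t) ^ (N - 1)) := by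
          gcongr
          have : 0 ≤ (4 / √t) ^ (N - 1) := by positivity
          linarith
      _ = |(k i : ℝ)| * (4 ^ N * (1 / √t) * (1 / √t) ^ N) := by
          obtain ⟨M, hM⟩ : ∃ M, N = M + 1 := ⟨N - 1, by have := i.pos; omega⟩
          rw [hM, Nat.add_sub_cancel, div_pow, div_pow, pow_succ, pow_succ]
          nth_rw 1 [← Real.mul_self_sqrt ht.le]
          field_simp
          ring
  calc |kernelDiff k t n| ≤ _ := abs_kernelDiff_le_sum ht.le k n
    _ ≤ ∑ i, |(k i : ℝ)| * (4 ^ N * (1 / √t) * (1 / √t) ^ N) := Finset.sum_le_sum fun i _ => h1 i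
    _ = _ := by rw [← Finset.sum_mul]; unfold size; ring

lemma abs_kernelDiff_le' {N : ℕ} {t : ℝ} (ht : 0 < t) (k n : Fin N → ℤ) :
    |kernelDiff k t n| ≤ 4 ^ N * (1 / √t) ^ N := by
  have h1 := heatKernel_le ht (n - k)
  have h2 := heatKernel_le ht n
  have h3 := heatKernel_nonneg ht.le (n - k)
  have h4 := heatKernel_nonneg ht.le n
  have h5 : (2 / √t) ^ N ≤ 4 ^ N * (1 / √t) ^ N := by
    rw [← mul_pow]
    gcongr
    rw [mul_one_div]
    gcongr
    norm_num
  unfold kernelDiff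
  rw [abs_le]
  constructor <;> linarith

lemma abs_kernelDiff_le_one {N : ℕ} {t : ℝ} (ht : 0 ≤ t) (k n : Fin N → ℤ) :
    |kernelDiff k t n| ≤ 1 := by
  have h1 := heatKernel_le_one ht (n - k)
  have h2 := heatKernel_le_one ht n
  have h3 := heatKernel_nonneg ht (n - k)
  have h4 := heatKernel_nonneg ht n
  unfold kernelDiff
  rw [abs_le]
  constructor <;> linarith

lemma tsum_kernelDiff_le_two {N : ℕ} {t : ℝ} (ht : 0 ≤ t) (k : Fin N → ℤ) :
    ∑' n, ENNReal.ofReal |kernelDiff k t n| ≤ 2 := by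
  calc _ ≤ ∑' n, (ENNReal.ofReal (heatKernel t (n - k)) + ENNReal.ofReal (heatKernel t (n - 0))) := by
        refine ENNReal.tsum_le_tsum fun n => ?_
        have h3 := heatKernel_nonneg ht (n - k)
        have h4 := heatKernel_nonneg ht (n - 0)
        rw [← ENNReal.ofReal_add h3 h4]
        refine ENNReal.ofReal_le_ofReal ?_
        rw [sub_zero] at *
        unfold kernelDiff
        rw [abs_le]
        constructor <;> linarith
    _ ≤ 1 + 1 := by
        rw [ENNReal.tsum_add]
        exact add_le_add (tsum_ofReal_heatKernel_le ht k) (tsum_ofReal_heatKernel_le ht 0)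
    _ = 2 := one_add_one_eq_two

/-- The `ℓ^1` counterpart: one coordinate contributes the variation `|k i| · 4/√t`, each other one a
mass of at most `2`. -/
lemma tsum_kernelDiff_le {N : ℕ} {t : ℝ} (ht : 0 < t) (k : Fin N → ℤ) :
    ∑' n, ENNReal.ofReal |kernelDiff k t n| ≤ ENNReal.ofReal (4 * 2 ^ N * (size k / √t)) := by
  have hs : 0 < √t := Real.sqrt_pos.2 ht
  have hp := fun n => profile_nonneg ht.le n
  have hj : ∀ i j : Fin N, ∑' m : ℤ, ENNReal.ofReal (if j = i
      then |profile t (m - k j).natAbs - profile t m.natAbs|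
      else profile t (m - k j).natAbs + profile t m.natAbs) ≤
      if j = i then ENNReal.ofReal (|(k i : ℝ)| * (4 / √t)) else 2 := fun i j => by
    split_ifs with h
    · subst h
      refine (tsum_ofReal_abs_shift_le ht.le (k j)).trans (ENNReal.ofReal_le_ofReal ?_)
      have := profile_zero_le ht
      gcongr
      calc 2 * profile t 0 ≤ 2 * (2 / √t) := by gcongr
        _ = 4 / √t := by ring
    · simp_rw [ENNReal.ofReal_add (hp _) (hp _)]
      rw [ENNReal.tsum_add, ← one_add_one_eq_two]
      refine add_le_add (tsum_ofReal_profile_le ht.le _) ?_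
      simpa using tsum_ofReal_profile_le ht.le 0
  have h1 : ∀ i : Fin N, ∑' n : Fin N → ℤ, ENNReal.ofReal (∏ j, if j = i
      then |profile t (n j - k j).natAbs - profile t (n j).natAbs|
      else profile t (n j - k j).natAbs + profile t (n j).natAbs) ≤
      ENNReal.ofReal (|(k i : ℝ)| * (4 / √t) * 2 ^ N) := fun i => by
    have e : ∀ n : Fin N → ℤ, ENNReal.ofReal (∏ j, if j = i
      then |profile t (n j - k j).natAbs - profile t (n j).natAbs|
      else profile t (n j - k j).natAbs + profile t (n j).natAbs) = ∏ j, ENNReal.ofReal (if j = i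
      then |profile t (n j - k j).natAbs - profile t (n j).natAbs|
      else profile t (n j - k j).natAbs + profile t (n j).natAbs) := fun n =>
        ENNReal.ofReal_prod_of_nonneg fun j _ => by
          split_ifs
          · exact abs_nonneg _
          · exact add_nonneg (hp _) (hp _)
    simp_rw [e]
    calc _ ≤ _ := tsum_prod_le_prod_tsum fun j m => ENNReal.ofReal (if j = i
          then |profile t (m - k j).natAbs - profile t m.natAbs|
          else profile t (m - k j).natAbs + profile t m.natAbs)
      _ ≤ ∏ j, if j = i then ENNReal.ofReal (|(k i : ℝ)| * (4 / √t)) else 2 :=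
          Finset.prod_le_prod' fun j _ => hj i j
      _ = ENNReal.ofReal (|(k i : ℝ)| * (4 / √t)) * 2 ^ (N - 1) := prod_ite_eq_mul_pow i _ _
      _ ≤ ENNReal.ofReal (|(k i : ℝ)| * (4 / √t)) * 2 ^ N := by
          gcongr
          · norm_num
          · omega
      _ = _ := by
          rw [ENNReal.ofReal_mul (by positivity : (0 : ℝ) ≤ |(k i : ℝ)| * (4 / √t)),
            ENNReal.ofReal_pow (by norm_num)]
          norm_num
  calc _ ≤ ∑' n : Fin N → ℤ, ∑ i, ENNReal.ofReal (∏ j, if j = i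
          then |profile t (n j - k j).natAbs - profile t (n j).natAbs|
          else profile t (n j - k j).natAbs + profile t (n j).natAbs) := by
        refine ENNReal.tsum_le_tsum fun n => ?_
        rw [← ENNReal.ofReal_sum_of_nonneg]
        · exact ENNReal.ofReal_le_ofReal (abs_kernelDiff_le_sum ht.le k n)
        · refine fun i _ => Finset.prod_nonneg fun j _ => ?_
          split_ifs
          · exact abs_nonneg _
          · exact add_nonneg (hp _) (hp _)
    _ = ∑ i, ∑' n : Fin N → ℤ, ENNReal.ofReal (∏ j, if j = i
          then |profile t (n j - k j).natAbs - profile t (n j).natAbs|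
          else profile t (n j - k j).natAbs + profile t (n j).natAbs) :=
        Summable.tsum_finsetSum fun i _ => ENNReal.summable
    _ ≤ ∑ i, ENNReal.ofReal (|(k i : ℝ)| * (4 / √t) * 2 ^ N) := Finset.sum_le_sum fun i _ => h1 i
    _ = _ := by
        rw [← ENNReal.ofReal_sum_of_nonneg fun i _ => by positivity, ← Finset.sum_mul,
          ← Finset.sum_mul]
        unfold size
        congr 1; ring

/-! ### Measurability and integrability in time. -/

lemma measurable_profile (n : ℕ) : Measurable fun t => profile t n := by
  have h : StronglyMeasurable fun t => ∑' k, besselTerm t n k :=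
    StronglyMeasurable.tsum fun k => by
      unfold besselTerm
      exact ((measurable_id.pow_const _).div_const _).stronglyMeasurable
  exact (by fun_prop : Measurable fun t : ℝ => Real.exp (-(2 * t))).mul h.measurable

lemma measurable_heatKernel {N : ℕ} (n : Fin N → ℤ) : Measurable fun t => heatKernel t n := by
  simp_rw [heatKernel_eq]
  exact Finset.measurable_prod _ fun i _ => measurable_profile _

lemma measurable_kernelDiff {N : ℕ} (k n : Fin N → ℤ) : Measurable fun t => kernelDiff k t n :=
  (measurable_heatKernel _).sub (measurable_heatKernel _)

/-- The model for all time integrals: `0 < σ` gives convergence at `0`, and `σ < β` at infinity. -/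
lemma integrableOn_rpow_mul_min {σ β : ℝ} (hσ : 0 < σ) (hβ : σ < β) :
    IntegrableOn (fun t : ℝ => t ^ (σ - 1) * min 1 (t ^ (-β))) (Set.Ioi 0) := by
  have hm : Measurable fun t : ℝ => t ^ (σ - 1) * min 1 (t ^ (-β)) := by fun_prop
  rw [← Set.Ioo_union_Ici_eq_Ioi zero_lt_one, integrableOn_union]
  constructor
  · refine Integrable.mono' ((intervalIntegral.integrableOn_Ioo_rpow_iff zero_lt_one).2
      (by linarith : -1 < σ - 1)) hm.aestronglyMeasurable ?_
    refine (ae_restrict_mem measurableSet_Ioo).mono fun t ht => ?_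
    have h0 : 0 ≤ t ^ (σ - 1) := Real.rpow_nonneg ht.1.le _
    have h1 : 0 ≤ t ^ (-β) := Real.rpow_nonneg ht.1.le _
    rw [Real.norm_of_nonneg (mul_nonneg h0 (le_min zero_le_one h1))]
    exact mul_le_of_le_one_right h0 (min_le_left _ _)
  · rw [integrableOn_Ici_iff_integrableOn_Ioi]
    refine Integrable.mono' (integrableOn_Ioi_rpow_of_lt (by linarith : σ - 1 - β < -1) zero_lt_one)
      hm.aestronglyMeasurable ?_
    refine (ae_restrict_mem measurableSet_Ioi).mono fun t ht => ?_
    have ht0 : 0 < t := zero_lt_one.trans ht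
    have h0 : 0 ≤ t ^ (σ - 1) := Real.rpow_nonneg ht0.le _
    have h1 : 0 ≤ t ^ (-β) := Real.rpow_nonneg ht0.le _
    rw [Real.norm_of_nonneg (mul_nonneg h0 (le_min zero_le_one h1)), sub_eq_add_neg (σ - 1),
      Real.rpow_add ht0]
    exact mul_le_mul_of_nonneg_left (min_le_right _ _) h0

lemma one_div_sqrt_pow {t : ℝ} (ht : 0 < t) (N : ℕ) : (1 / √t) ^ N = t ^ (-((N : ℝ) / 2)) := by
  rw [Real.sqrt_eq_rpow, one_div, ← Real.rpow_neg ht.le, ← Real.rpow_natCast, ← Real.rpow_mul ht.le]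
  congr 1; ring

lemma heatKernel_le_min {N : ℕ} {t : ℝ} (ht : 0 < t) (n : Fin N → ℤ) :
    heatKernel t n ≤ 2 ^ N * min 1 (t ^ (-((N : ℝ) / 2))) := by
  rw [mul_min_of_nonneg _ _ (by positivity), mul_one, ← one_div_sqrt_pow ht, ← mul_pow,
    mul_one_div]
  exact le_min ((heatKernel_le_one ht.le n).trans (one_le_pow₀ one_le_two)) (heatKernel_le ht n)

lemma integrableOn_heatKernel {N : ℕ} {σ : ℝ} (hσ : 0 < 2 * σ) (hσN : 2 * σ < N)
    (n : Fin N → ℤ) :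
    IntegrableOn (fun t : ℝ => t ^ (σ - 1) * heatKernel t n) (Set.Ioi 0) := by
  refine Integrable.mono' ((integrableOn_rpow_mul_min (by linarith : 0 < σ)
    (by linarith : σ < (N : ℝ) / 2)).const_mul (2 ^ N))
    ((Measurable.pow_const measurable_id _).mul (measurable_heatKernel n)).aestronglyMeasurable ?_
  refine (ae_restrict_mem measurableSet_Ioi).mono fun t (ht : 0 < t) => ?_
  have h0 : 0 ≤ t ^ (σ - 1) := Real.rpow_nonneg ht.le _
  rw [Real.norm_of_nonneg (mul_nonneg h0 (heatKernel_nonneg ht.le n)), mul_left_comm]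
  exact mul_le_mul_of_nonneg_left (heatKernel_le_min ht n) h0

/-! ### Translation estimates in `ℓ^p` for the heat kernel and for `K_σ`. -/

lemma one_le_size {N : ℕ} {k : Fin N → ℤ} (hk : k ≠ 0) : 1 ≤ size k := by
  obtain ⟨i, hi⟩ := Function.ne_iff.1 hk
  have h1 : (1 : ℝ) ≤ |(k i : ℝ)| := by
    rw [← Int.cast_abs]
    exact_mod_cast Int.one_le_abs hi
  exact h1.trans (Finset.single_le_sum (f := fun i => |(k i : ℝ)|) (fun i _ => abs_nonneg _)
    (Finset.mem_univ i))

lemma LpLe.const_mul {ι : Type*} {p : ℝ≥0∞} {h : ι → ℝ≥0∞} {B : ℝ≥0∞} (H : LpLe p h B)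
    (c : ℝ≥0∞) : LpLe p (fun n => c * h n) (c * B) := by
  unfold LpLe at *
  split_ifs at * with hp
  · exact fun n => mul_le_mul_right (H n) c
  · simp_rw [ENNReal.mul_rpow_of_nonneg _ _ ENNReal.toReal_nonneg]
    rw [ENNReal.tsum_mul_left]
    exact mul_le_mul_right H _

lemma LpLe.zero {ι : Type*} {p : ℝ≥0∞} (hp : 1 ≤ p) (B : ℝ≥0∞) :
    LpLe p (fun _ : ι => 0) B := by
  unfold LpLe
  split_ifs with hp'
  · exact fun n => zero_le
  · have : 0 < p.toReal := by linarith [one_le_toReal hp hp']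
    simp [this]

/-- With `x = |k|/√t`, the trivial and first-order bounds combine into `min(1, x) ≤ x^θ` for the
`ℓ^1` norm, and into the same times `t^(-N/2)` for the supremum, up to constants. Interpolation then
gives `x^θ t^(-(N/2)(1 - 1/p))`. -/
lemma LpLe.kernelDiff {N : ℕ} {p : ℝ≥0∞} (hp : 1 ≤ p) {θ : ℝ} (hθ : 0 ≤ θ) (hθ1 : θ ≤ 1)
    {k : Fin N → ℤ} (hk : k ≠ 0) {t : ℝ} (ht : 0 < t) :
    LpLe p (fun n => ENNReal.ofReal |kernelDiff k t n|)
      (ENNReal.ofReal (4 ^ (N + 1) * size k ^ θ *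
        min 1 (t ^ (-(θ / 2 + (N : ℝ) / 2 * (1 - (1 / p).toReal)))))) := by
  have hsz := one_le_size hk
  have hs : 0 < √t := Real.sqrt_pos.2 ht
  have hα : 0 ≤ 1 - (1 / p).toReal := by
    have : (1 / p).toReal ≤ (1 : ℝ≥0∞).toReal :=
      ENNReal.toReal_mono ENNReal.one_ne_top (by simpa using hp)
    rw [ENNReal.toReal_one] at this
    linarith
  set α := 1 - (1 / p).toReal
  have h4 : (4 : ℝ) ≤ 4 ^ (N + 1) := by
    rw [pow_succ]
    have : (1 : ℝ) ≤ 4 ^ N := one_le_pow₀ (by norm_num)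
    linarith
  have h4' : (4 : ℝ) ^ N ≤ 4 ^ (N + 1) := pow_le_pow_right₀ (by norm_num) (by omega)
  have h2 : 4 * (2 : ℝ) ^ N ≤ 4 ^ (N + 1) := by
    rw [pow_succ, mul_comm]
    gcongr
    norm_num
  rcases le_total (1 : ℝ) (t ^ (-(θ / 2 + (N : ℝ) / 2 * α))) with hle | hle
  · rw [min_eq_left hle, mul_one]
    -- When the minimum is `1` the trivial bound `2` is enough, since `k ≠ 0` forces `size k ≥ 1`.
    have hb : (4 : ℝ) ≤ 4 ^ (N + 1) * size k ^ θ := by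
      have : 1 ≤ size k ^ θ := Real.one_le_rpow hsz hθ
      nlinarith
    refine (LpLe.of_tsum_le_of_le hp (M := 1) (tsum_kernelDiff_le_two ht.le k) fun n => ?_).mono
      (fun _ => le_rfl) ?_
    · rw [mul_one]
      refine (ENNReal.ofReal_le_ofReal (abs_kernelDiff_le_one ht.le k n)).trans ?_
      rw [ENNReal.ofReal_one]
      exact one_le_two
    · rw [ENNReal.one_rpow, mul_one, ← ENNReal.ofReal_ofNat 2]
      exact ENNReal.ofReal_le_ofReal (by linarith)
  · rw [min_eq_right hle]
    set x := size k / √t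
    have hx : 0 < x := by positivity
    have hxθ : min 1 x ≤ x ^ θ := by
      rcases le_total x 1 with h | h
      · refine (min_le_right _ _).trans ?_
        simpa using Real.rpow_le_rpow_of_exponent_ge hx h hθ1
      · exact (min_le_left _ _).trans (Real.one_le_rpow h hθ)
    have hC : 0 ≤ 4 ^ (N + 1) * x ^ θ := by positivity
    have hmin : ∀ y, y ≤ (4 : ℝ) ^ (N + 1) → y ≤ 4 ^ (N + 1) * x → y ≤ 4 ^ (N + 1) * x ^ θ :=
      fun y h1 h2 => by
        calc y ≤ 4 ^ (N + 1) * min 1 x := by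
              rw [mul_min_of_nonneg _ _ (by positivity), mul_one]
              exact le_min h1 h2
          _ ≤ _ := by gcongr
    have hM : 0 < (1 / √t) ^ N := by positivity
    refine (LpLe.of_tsum_le_of_le hp (X := ENNReal.ofReal (4 ^ (N + 1) * x ^ θ))
      (M := ENNReal.ofReal ((1 / √t) ^ N)) ?_ fun n => ?_).mono (fun _ => le_rfl) ?_
    · rcases le_total 1 x with h | h
      · refine (tsum_kernelDiff_le_two ht.le k).trans ?_
        rw [← ENNReal.ofReal_ofNat 2]
        exact ENNReal.ofReal_le_ofReal (hmin _ (by linarith) (by nlinarith))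
      · refine (tsum_kernelDiff_le ht k).trans (ENNReal.ofReal_le_ofReal (hmin _ ?_ ?_))
        · calc _ ≤ 4 * (2 : ℝ) ^ N * 1 := by gcongr
            _ ≤ _ := by linarith
        · gcongr
    · rw [← ENNReal.ofReal_mul hC]
      refine ENNReal.ofReal_le_ofReal ?_
      rw [← div_le_iff₀ hM]
      refine hmin _ ?_ ?_
      · rw [div_le_iff₀ hM]
        refine (abs_kernelDiff_le' ht k n).trans ?_
        gcongr
      · rw [div_le_iff₀ hM]
        refine (abs_kernelDiff_le ht k n).trans ?_
        gcongr
    · rw [ENNReal.ofReal_rpow_of_nonneg hM.le hα, ← ENNReal.ofReal_mul hC]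
      refine ENNReal.ofReal_le_ofReal (le_of_eq ?_)
      rw [one_div_sqrt_pow ht, ← Real.rpow_mul ht.le, Real.div_rpow (by linarith) hs.le,
        Real.sqrt_eq_rpow, ← Real.rpow_mul ht.le, neg_add, Real.rpow_add ht, div_eq_mul_inv,
        ← Real.rpow_neg ht.le, mul_assoc, mul_assoc, mul_assoc]
      congr 4 <;> ring

lemma fracKernel_sub {N : ℕ} {σ : ℝ} (hσ : 0 < 2 * σ) (hσN : 2 * σ < N) (k n : Fin N → ℤ) :
    fracKernel σ (n - k) - fracKernel σ n =
      (Real.Gamma σ)⁻¹ * ∫ t in Set.Ioi (0 : ℝ), t ^ (σ - 1) * kernelDiff k t n := by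
  unfold fracKernel kernelDiff
  simp_rw [mul_sub]
  rw [integral_sub (integrableOn_heatKernel hσ hσN _) (integrableOn_heatKernel hσ hσN _), mul_sub]

lemma exists_lpLe_fracKernel_sub {N : ℕ} {σ : ℝ} (hσ : 0 < 2 * σ) (hσN : 2 * σ < N) {p : ℝ≥0∞}
    (hp : 1 ≤ p) {θ : ℝ} (hθ : 0 ≤ θ) (hθ1 : θ ≤ 1)
    (hβ : σ < θ / 2 + (N : ℝ) / 2 * (1 - (1 / p).toReal)) :
    ∃ C : ℝ, 0 ≤ C ∧ ∀ k : Fin N → ℤ,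
      LpLe p (fun n => ‖fracKernel σ (n - k) - fracKernel σ n‖ₑ)
        (ENNReal.ofReal (C * size k ^ θ)) := by
  set β := θ / 2 + (N : ℝ) / 2 * (1 - (1 / p).toReal)
  have hint := integrableOn_rpow_mul_min (by linarith : 0 < σ) hβ
  have hnn : ∀ t ∈ Set.Ioi (0 : ℝ), 0 ≤ t ^ (σ - 1) * min 1 (t ^ (-β)) := fun t ht =>
    mul_nonneg (Real.rpow_nonneg (le_of_lt ht) _)
      (le_min zero_le_one (Real.rpow_nonneg (le_of_lt ht) _))
  have hI : 0 ≤ ∫ t in Set.Ioi (0 : ℝ), t ^ (σ - 1) * min 1 (t ^ (-β)) :=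
    setIntegral_nonneg measurableSet_Ioi hnn
  refine ⟨|(Real.Gamma σ)⁻¹| * (4 ^ (N + 1) *
    ∫ t in Set.Ioi (0 : ℝ), t ^ (σ - 1) * min 1 (t ^ (-β))), by positivity, fun k => ?_⟩
  by_cases hk : k = 0
  · subst hk
    simpa using LpLe.zero hp _
  have hsz : 0 ≤ size k ^ θ := Real.rpow_nonneg (size_nonneg k) _
  -- Extension by zero to `t ≤ 0`, since Minkowski's inequality is stated with bounds at every point
  -- of the measure space.
  set F : (Fin N → ℤ) → ℝ → ℝ≥0∞ := fun n => (Set.Ioi (0 : ℝ)).indicator fun t =>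
    ENNReal.ofReal (t ^ (σ - 1)) * ENNReal.ofReal |kernelDiff k t n|
  set A : ℝ → ℝ≥0∞ := (Set.Ioi (0 : ℝ)).indicator fun t =>
    ENNReal.ofReal (t ^ (σ - 1)) *
      ENNReal.ofReal (4 ^ (N + 1) * size k ^ θ * min 1 (t ^ (-β)))
  have hF : ∀ n, Measurable (F n) := fun n => by
    refine Measurable.indicator ?_ measurableSet_Ioi
    exact ((measurable_id.pow_const _).ennreal_ofReal).mul
      (measurable_kernelDiff k n).abs.ennreal_ofReal
  have hA : Measurable A := by
    refine Measurable.indicator ?_ measurableSet_Ioi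
    fun_prop
  have hA' : ∀ t, A t ≠ ∞ := fun t => by
    by_cases ht : t ∈ Set.Ioi (0 : ℝ)
    · simp only [A, Set.indicator_of_mem ht]
      exact ENNReal.mul_ne_top ENNReal.ofReal_ne_top ENNReal.ofReal_ne_top
    · simp only [A, Set.indicator_of_notMem ht]
      exact ENNReal.zero_ne_top
  have hFA : ∀ t, LpLe p (fun n => F n t) (A t) := fun t => by
    by_cases ht : t ∈ Set.Ioi (0 : ℝ)
    · simp only [F, A, Set.indicator_of_mem ht]
      exact (LpLe.kernelDiff hp hθ hθ1 hk ht).const_mul _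
    · simp only [F, A, Set.indicator_of_notMem ht]
      exact LpLe.zero hp _
  refine ((LpLe.lintegral volume hp hF hA hA' hFA).const_mul ‖(Real.Gamma σ)⁻¹‖ₑ).mono
    (fun n => ?_) (le_of_eq ?_)
  · rw [fracKernel_sub hσ hσN, enorm_mul]
    refine mul_le_mul_right ((enorm_integral_le_lintegral_enorm _).trans (le_of_eq ?_)) _
    rw [lintegral_indicator measurableSet_Ioi]
    refine setLIntegral_congr_fun measurableSet_Ioi fun t (ht : 0 < t) => ?_
    rw [enorm_mul, Real.enorm_eq_ofReal_abs, Real.enorm_eq_ofReal_abs,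
      abs_of_nonneg (Real.rpow_nonneg ht.le _)]
  · rw [lintegral_indicator measurableSet_Ioi, Real.enorm_eq_ofReal_abs]
    have e : ∀ t ∈ Set.Ioi (0 : ℝ), ENNReal.ofReal (t ^ (σ - 1)) *
        ENNReal.ofReal (4 ^ (N + 1) * size k ^ θ * min 1 (t ^ (-β))) =
        ENNReal.ofReal (4 ^ (N + 1) * size k ^ θ) *
          ENNReal.ofReal (t ^ (σ - 1) * min 1 (t ^ (-β))) := fun t ht => by
      rw [← ENNReal.ofReal_mul (Real.rpow_nonneg (le_of_lt ht) _),
        ← ENNReal.ofReal_mul (by positivity)]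
      congr 1; ring
    rw [setLIntegral_congr_fun measurableSet_Ioi e, lintegral_const_mul _ (by fun_prop),
      ← ofReal_integral_eq_lintegral_ofReal hint
        ((ae_restrict_mem measurableSet_Ioi).mono hnn),
      ← ENNReal.ofReal_mul (by positivity), ← ENNReal.ofReal_mul (by positivity)]
    congr 1; ring

/-! ### Weighted summability of `f` by Hölder's inequality. -/

lemma summable_one_add_abs_rpow {b : ℝ} (hb : 1 < b) :
    Summable fun m : ℤ => (1 + |(m : ℝ)|) ^ (-b) := by
  refine Summable.of_norm_bounded_eventually (Real.summable_abs_int_rpow hb) ?_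
  refine (Filter.eventually_cofinite_ne (0 : ℤ)).mono fun m hm => ?_
  have h0 : 0 < |(m : ℝ)| := abs_pos.2 (Int.cast_ne_zero.2 hm)
  rw [Real.norm_of_nonneg (by positivity)]
  exact Real.rpow_le_rpow_of_nonpos h0 (by linarith) (by linarith)

/-- Split `(1 + |k|)^(-s)` into `N` equal powers and bound one by each `(1 + |k i|)^(-s/N)`: the
result is a product of convergent one-dimensional series. -/
lemma summable_size_rpow {N : ℕ} (hN : 0 < N) {s : ℝ} (hs : (N : ℝ) < s) :
    Summable fun k : Fin N → ℤ => size k ^ (-s) := by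
  have hN' : (0 : ℝ) < N := Nat.cast_pos.2 hN
  set b := s / N
  have hb : 1 < b := (one_lt_div hN').2 hs
  have h1 := summable_one_add_abs_rpow hb
  have hprod : Summable fun k : Fin N → ℤ => ∏ i, (1 + |(k i : ℝ)|) ^ (-b) := by
    have h2 : ∑' k : Fin N → ℤ, ∏ i, ENNReal.ofReal ((1 + |(k i : ℝ)|) ^ (-b)) ≠ ∞ := by
      refine ne_top_of_le_ne_top ?_
        (tsum_prod_le_prod_tsum fun _ m => ENNReal.ofReal ((1 + |(m : ℝ)|) ^ (-b)))
      exact ENNReal.prod_ne_top fun i _ => h1.tsum_ofReal_ne_top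
    refine (ENNReal.summable_toReal h2).congr fun k => ?_
    rw [ENNReal.toReal_prod]
    exact Finset.prod_congr rfl fun i _ => ENNReal.toReal_ofReal (by positivity)
  refine Summable.of_norm_bounded_eventually (hprod.mul_left (2 ^ s)) ?_
  refine (Filter.eventually_cofinite_ne (0 : Fin N → ℤ)).mono fun k hk => ?_
  have hsz := one_le_size hk
  rw [Real.norm_of_nonneg (by positivity)]
  have h3 : ((1 + size k) ^ (-b)) ^ N ≤ ∏ i, (1 + |(k i : ℝ)|) ^ (-b) := by
    calc ((1 + size k) ^ (-b)) ^ N = ∏ _i : Fin N, (1 + size k) ^ (-b) := by simp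
      _ ≤ _ := by
        refine Finset.prod_le_prod (fun i _ => by positivity) fun i _ => ?_
        refine Real.rpow_le_rpow_of_nonpos (by positivity) ?_ (by linarith)
        gcongr
        exact Finset.single_le_sum (f := fun i => |(k i : ℝ)|) (fun i _ => abs_nonneg _)
          (Finset.mem_univ i)
  have h4 : ((1 + size k) ^ (-b)) ^ N = (1 + size k) ^ (-s) := by
    rw [← Real.rpow_natCast, ← Real.rpow_mul (by positivity)]
    congr 1
    simp only [b]; field_simp
  calc size k ^ (-s) = 2 ^ s * (2 * size k) ^ (-s) := by
        rw [Real.mul_rpow (by norm_num) (by positivity), ← mul_assoc, ← Real.rpow_add two_pos]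
        simp
    _ ≤ 2 ^ s * (1 + size k) ^ (-s) := by
        gcongr 2 ^ s * ?_
        exact Real.rpow_le_rpow_of_nonpos (by positivity) (by linarith) (by linarith)
    _ ≤ _ := by
        rw [← h4]
        gcongr

lemma size_zero {N : ℕ} : size (0 : Fin N → ℤ) = 0 := by simp [size]

section

variable {𝕜 : Type*} [RCLike 𝕜] {N : ℕ}

lemma norm_sizeMul (f : (Fin N → ℤ) → 𝕜) (k : Fin N → ℤ) :
    ‖sizeMul f k‖ = size k * ‖f k‖ := by
  unfold sizeMul
  rw [norm_mul, RCLike.norm_ofReal, abs_of_nonneg (size_nonneg k)]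

lemma size_rpow_mul_norm {θ : ℝ} (hθ : 0 < θ) (f : (Fin N → ℤ) → 𝕜) (k : Fin N → ℤ) :
    size k ^ θ * ‖f k‖ = ‖sizeMul f k‖ * size k ^ (θ - 1) := by
  rw [norm_sizeMul]
  by_cases hk : k = 0
  · subst hk
    rw [size_zero, Real.zero_rpow hθ.ne']
    ring
  · have := one_le_size hk
    rw [Real.rpow_sub_one (by positivity)]
    field_simp

lemma exists_tsum_size_rpow_mul_norm_le (hN : 0 < N) {q : ℝ≥0∞} (hq : 1 ≤ q) (hq' : q ≠ ∞) {θ : ℝ}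
    (hθ : 0 < θ) (hθ1 : θ < 1 - N * (1 - 1 / q.toReal)) :
    ∃ C : ℝ, 0 ≤ C ∧ ∀ (f : (Fin N → ℤ) → 𝕜) (hf : Memℓp (sizeMul f) q),
      (Summable fun k => size k ^ θ * ‖f k‖) ∧
      ∑' k, size k ^ θ * ‖f k‖ ≤ C * ‖(⟨sizeMul f, hf⟩ : lp (fun _ : Fin N → ℤ => 𝕜) q)‖ := by
  have hr := one_le_toReal hq hq'
  have hr0 : 0 < q.toReal := by linarith
  have hg : ∀ k : Fin N → ℤ, 0 ≤ size k ^ (θ - 1) := fun k => Real.rpow_nonneg (size_nonneg k) _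
  simp_rw [fun f : (Fin N → ℤ) → 𝕜 => funext (size_rpow_mul_norm hθ f)]
  rcases hr.eq_or_lt with h1 | h1
  · rw [← h1] at hθ1
    have hθ1' : θ < 1 := by simpa using hθ1
    have hle : ∀ k : Fin N → ℤ, size k ^ (θ - 1) ≤ 1 := fun k => by
      by_cases hk : k = 0
      -- At the origin the negative power is `0` by convention, so the weight is bounded there too.
      · rw [hk, size_zero, Real.zero_rpow (by linarith)]
        exact zero_le_one
      · exact Real.rpow_le_one_of_one_le_of_nonpos (one_le_size hk) (by linarith)
    refine ⟨1, zero_le_one, fun f hf => ?_⟩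
    have hs : Summable fun k => ‖sizeMul f k‖ := by
      have := hf.summable hr0
      rw [← h1] at this
      simpa using this
    have hb : ∀ k, ‖sizeMul f k‖ * size k ^ (θ - 1) ≤ ‖sizeMul f k‖ := fun k =>
      mul_le_of_le_one_right (norm_nonneg _) (hle k)
    have hs' := Summable.of_nonneg_of_le (fun k => mul_nonneg (norm_nonneg _) (hg k)) hb hs
    refine ⟨hs', (hs'.tsum_le_tsum hb hs).trans (le_of_eq ?_)⟩
    rw [lp.norm_eq_tsum_rpow hr0, ← h1]
    simp
  · have hc := Real.HolderConjugate.conjExponent h1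
    set s := q.toReal.conjExponent
    have hs0 : 0 < s := hc.symm.pos
    have hinv : 1 - 1 / q.toReal = 1 / s := by
      have := hc.inv_add_inv_eq_one
      rw [one_div, one_div]; linarith
    have hsum : Summable fun k : Fin N → ℤ => (size k ^ (θ - 1)) ^ s := by
      have : (N : ℝ) < (1 - θ) * s := by
        rw [hinv, mul_one_div] at hθ1
        have : (N : ℝ) / s < 1 - θ := by linarith
        rwa [div_lt_iff₀ hs0] at this
      refine (summable_size_rpow hN this).congr fun k => ?_
      rw [← Real.rpow_mul (size_nonneg k)]
      congr 1; ring
    refine ⟨(∑' k : Fin N → ℤ, (size k ^ (θ - 1)) ^ s) ^ (1 / s),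
      Real.rpow_nonneg (tsum_nonneg fun k => Real.rpow_nonneg (hg k) _) _, fun f hf => ?_⟩
    have H := Real.summable_and_inner_le_Lp_mul_Lq_tsum_of_nonneg hc
      (fun k => norm_nonneg (sizeMul f k)) hg (hf.summable hr0) hsum
    refine ⟨H.1, H.2.trans (le_of_eq ?_)⟩
    rw [lp.norm_eq_tsum_rpow hr0, mul_comm]

/-- The weight vanishes at the origin and says nothing about `f 0`, but a single term does not
affect summability. -/
lemma summable_norm_of_summable_size_rpow {θ : ℝ} (hθ : 0 ≤ θ) {f : (Fin N → ℤ) → 𝕜}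
    (h : Summable fun k => size k ^ θ * ‖f k‖) : Summable fun k => ‖f k‖ := by
  refine Summable.of_norm_bounded_eventually h ?_
  refine (Filter.eventually_cofinite_ne (0 : Fin N → ℤ)).mono fun k hk => ?_
  rw [norm_norm]
  exact le_mul_of_one_le_left (norm_nonneg _) (Real.one_le_rpow (one_le_size hk) hθ)

/-! ### Kernel representation of the fractional integral and of the defect. -/

lemma norm_heatKernel_mul_le {t : ℝ} (ht : 0 ≤ t) (f : (Fin N → ℤ) → 𝕜) (m k : Fin N → ℤ) :
    ‖(heatKernel t m : 𝕜) * f k‖ ≤ ‖f k‖ := by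
  rw [norm_mul, RCLike.norm_ofReal, abs_of_nonneg (heatKernel_nonneg ht _)]
  exact mul_le_of_le_one_left (norm_nonneg _) (heatKernel_le_one ht _)

lemma summable_heatKernel_mul {t : ℝ} (ht : 0 ≤ t) {f : (Fin N → ℤ) → 𝕜}
    (hf : Summable fun k => ‖f k‖) (n : Fin N → ℤ) :
    Summable fun k : Fin N → ℤ => (heatKernel t (n - k) : 𝕜) * f k :=
  hf.of_norm_bounded fun k => norm_heatKernel_mul_le ht f (n - k) k

lemma norm_heat_le {t : ℝ} (ht : 0 < t) {f : (Fin N → ℤ) → 𝕜} (hf : Summable fun k => ‖f k‖)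
    (n : Fin N → ℤ) :
    ‖heat t f n‖ ≤ 2 ^ N * min 1 (t ^ (-((N : ℝ) / 2))) * ∑' k, ‖f k‖ := by
  refine tsum_of_norm_bounded (hf.hasSum.mul_left _) fun k => ?_
  rw [norm_mul, RCLike.norm_ofReal, abs_of_nonneg (heatKernel_nonneg ht.le _)]
  exact mul_le_mul_of_nonneg_right (heatKernel_le_min ht _) (norm_nonneg _)

lemma integrableOn_heat {σ : ℝ} (hσ : 0 < 2 * σ) (hσN : 2 * σ < N) {f : (Fin N → ℤ) → 𝕜}
    (hf : Summable fun k => ‖f k‖) (n : Fin N → ℤ) :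
    IntegrableOn (fun t : ℝ => (t ^ (σ - 1) : ℝ) • heat t f n) (Set.Ioi 0) := by
  refine Integrable.mono' ((integrableOn_rpow_mul_min (by linarith : 0 < σ)
    (by linarith : σ < (N : ℝ) / 2)).const_mul (2 ^ N * ∑' k, ‖f k‖)) ?_ ?_
  · refine AEStronglyMeasurable.smul (by fun_prop) ?_
    refine AEStronglyMeasurable.tsum fun k => ?_
    exact ((RCLike.measurable_ofReal.comp (measurable_heatKernel (n - k))).mul_const
      (f k)).aestronglyMeasurable
  · refine (ae_restrict_mem measurableSet_Ioi).mono fun t (ht : 0 < t) => ?_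
    have h0 : 0 ≤ t ^ (σ - 1) := Real.rpow_nonneg ht.le _
    rw [norm_smul, Real.norm_of_nonneg h0]
    refine (mul_le_mul_of_nonneg_left (norm_heat_le ht hf n) h0).trans (le_of_eq ?_)
    ring

/-- Sum and time integral are exchanged thanks to the bound `2^N t^(σ-1) min(1, t^(-N/2))`, uniform
in `k`, and the summability of `f`. -/
lemma hasSum_fracIntegral {σ : ℝ} (hσ : 0 < 2 * σ) (hσN : 2 * σ < N) {f : (Fin N → ℤ) → 𝕜}
    (hf : Summable fun k => ‖f k‖) (n : Fin N → ℤ) :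
    HasSum (fun k => (fracKernel σ (n - k) : 𝕜) * f k) (fracIntegral σ f n) := by
  have hφ := integrableOn_rpow_mul_min (by linarith : 0 < σ) (by linarith : σ < (N : ℝ) / 2)
  set F : (Fin N → ℤ) → ℝ → 𝕜 := fun k t =>
    ((t ^ (σ - 1) * heatKernel t (n - k) : ℝ) : 𝕜) * f k with hFdef
  have hF : ∀ k, Integrable (F k) (volume.restrict (Set.Ioi 0)) := fun k =>
    (integrableOn_heatKernel hσ hσN (n - k)).ofReal.mul_const (f k)
  have hpos : ∀ k : Fin N → ℤ, ∀ t ∈ Set.Ioi (0 : ℝ), 0 ≤ t ^ (σ - 1) * heatKernel t (n - k) :=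
    fun k t ht => mul_nonneg (Real.rpow_nonneg (le_of_lt ht) _) (heatKernel_nonneg (le_of_lt ht) _)
  have hFn : ∀ k, ∫ t in Set.Ioi (0 : ℝ), ‖F k t‖ =
      (∫ t in Set.Ioi (0 : ℝ), t ^ (σ - 1) * heatKernel t (n - k)) * ‖f k‖ := fun k => by
    rw [← integral_mul_const]
    refine setIntegral_congr_fun measurableSet_Ioi fun t ht => ?_
    simp only [hFdef]
    rw [norm_mul, RCLike.norm_ofReal, abs_of_nonneg (hpos k t ht)]
  have hsum : Summable fun k => ∫ t in Set.Ioi (0 : ℝ), ‖F k t‖ := by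
    simp_rw [hFn]
    refine Summable.of_nonneg_of_le (fun k => mul_nonneg
      (setIntegral_nonneg measurableSet_Ioi (hpos k)) (norm_nonneg _)) (fun k => ?_)
      (hf.mul_left (∫ t in Set.Ioi (0 : ℝ), 2 ^ N * (t ^ (σ - 1) * min 1 (t ^ (-((N : ℝ) / 2))))))
    refine mul_le_mul_of_nonneg_right ?_ (norm_nonneg _)
    refine setIntegral_mono_on (integrableOn_heatKernel hσ hσN _) (hφ.const_mul _)
      measurableSet_Ioi fun t (ht : 0 < t) => ?_
    rw [mul_left_comm]
    exact mul_le_mul_of_nonneg_left (heatKernel_le_min ht _) (Real.rpow_nonneg ht.le _)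
  have H := (hasSum_integral_of_summable_integral_norm hF hsum).mul_left
    (((Real.Gamma σ)⁻¹ : ℝ) : 𝕜)
  convert! H using 1
  · funext k
    rw [integral_mul_const, integral_ofReal, ← mul_assoc, ← RCLike.ofReal_mul]
    rfl
  · unfold fracIntegral
    rw [RCLike.real_smul_eq_coe_mul]
    congr 1
    refine integral_congr_ae (Filter.Eventually.of_forall fun t => ?_)
    simp only [hFdef, heat]
    rw [RCLike.real_smul_eq_coe_mul, ← tsum_mul_left]
    refine tsum_congr fun k => ?_
    rw [RCLike.ofReal_mul, mul_assoc]

lemma hasSum_fracDefect {σ : ℝ} (hσ : 0 < 2 * σ) (hσN : 2 * σ < N) {f : (Fin N → ℤ) → 𝕜}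
    (hf : Summable fun k => ‖f k‖) (n : Fin N → ℤ) :
    HasSum (fun k => ((fracKernel σ (n - k) - fracKernel σ n : ℝ) : 𝕜) * f k)
      (fracDefect σ f n) := by
  unfold fracDefect
  rw [mul_comm (∑' k, f k)]
  refine ((hasSum_fracIntegral hσ hσN hf n).sub
    (hf.of_norm.hasSum.mul_left (fracKernel σ n : 𝕜))).congr_fun ?_
  intro k
  rw [RCLike.ofReal_sub, sub_mul]

lemma LpLe.fracDefect {σ : ℝ} (hσ : 0 < 2 * σ) (hσN : 2 * σ < N) {p : ℝ≥0∞} (hp : 1 ≤ p)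
    {θ C : ℝ} (hC : 0 ≤ C)
    (H : ∀ k : Fin N → ℤ, LpLe p (fun n => ‖fracKernel σ (n - k) - fracKernel σ n‖ₑ)
      (ENNReal.ofReal (C * size k ^ θ)))
    {f : (Fin N → ℤ) → 𝕜} (hf : Summable fun k => ‖f k‖)
    (hfθ : Summable fun k => size k ^ θ * ‖f k‖) :
    LpLe p (fun n => ‖fracDefect σ f n‖ₑ)
      (ENNReal.ofReal (C * ∑' k, size k ^ θ * ‖f k‖)) := by
  refine (LpLe.tsum hp (F := fun n k => ‖f k‖ₑ * ‖fracKernel σ (n - k) - fracKernel σ n‖ₑ)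
    (A := fun k => ‖f k‖ₑ * ENNReal.ofReal (C * size k ^ θ))
    (fun k => ENNReal.mul_ne_top enorm_ne_top ENNReal.ofReal_ne_top)
    fun k => (H k).const_mul _).mono (fun n => ?_) (le_of_eq ?_)
  · rw [← (hasSum_fracDefect hσ hσN hf n).tsum_eq]
    refine enorm_tsum_le_tsum_enorm.trans (le_of_eq ?_)
    refine tsum_congr fun k => ?_
    rw [enorm_mul, mul_comm, ← ofReal_norm (((_ : ℝ) : 𝕜)), RCLike.norm_ofReal,
      Real.enorm_eq_ofReal_abs]
  · rw [← tsum_mul_left, ENNReal.ofReal_tsum_of_nonneg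
      (fun k => mul_nonneg hC (mul_nonneg (Real.rpow_nonneg (size_nonneg k) _) (norm_nonneg _)))
      (hfθ.mul_left C)]
    refine tsum_congr fun k => ?_
    rw [← ofReal_norm, ← ENNReal.ofReal_mul (norm_nonneg _)]
    congr 1; ring

end

/-! ### The choice of exponents and the conclusion. -/

lemma mul_one_sub_inv_lt_one {N : ℕ} (hN : 0 < N) {q : ℝ≥0∞} (hq : 1 ≤ q)
    (hqN : q < (N : ℝ≥0∞) / ((N : ℝ≥0∞) - 1)) : (N : ℝ) * (1 - 1 / q.toReal) < 1 := by
  have hr := one_le_toReal hq hqN.ne_top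
  obtain ⟨M, rfl⟩ : ∃ M, N = M + 1 := ⟨N - 1, by omega⟩
  rw [Nat.cast_add_one, ENNReal.add_sub_cancel_right ENNReal.one_ne_top] at hqN
  rcases Nat.eq_zero_or_pos M with rfl | hM
  -- For `N = 1` the bound on `q` reads `q < 1/0 = ∞`, and the claim is `1 - 1/q < 1`.
  · have : 0 < 1 / q.toReal := by positivity
    push_cast
    linarith
  · have hM' : (0 : ℝ) < M := Nat.cast_pos.2 hM
    have h : q.toReal < ((M : ℝ) + 1) / M := by
      have hfin : ((M : ℝ≥0∞) + 1) / M ≠ ∞ :=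
        ENNReal.div_ne_top (by simp) (by simpa using hM.ne')
      have := (ENNReal.toReal_lt_toReal hqN.ne_top hfin).2 hqN
      rwa [ENNReal.toReal_div, ENNReal.toReal_add (by simp) (by simp), ENNReal.toReal_natCast,
        ENNReal.toReal_one] at this
    rw [lt_div_iff₀ hM'] at h
    have h2 : ((M : ℝ) + 1) * (1 - 1 / q.toReal) = (M + 1) - (M + 1) / q.toReal := by ring
    push_cast
    rw [h2, sub_lt_comm, lt_div_iff₀ (by linarith)]
    linarith

end DiscreteHeat

theorem mainTheorem5 {𝕜 : Type*} [RCLike 𝕜] (N : ℕ) (σ : ℝ) (p q : ℝ≥0∞)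
    (hσ : 0 < 2 * σ) (hσN : 2 * σ < N)
    (hq : 1 ≤ q) (hqp : q ≤ p) (hqN : q < (N : ℝ≥0∞) / ((N : ℝ≥0∞) - 1))
    (hpq : (1 / p).toReal < (1 / q).toReal - (2 * σ - 1) / N) :
    -- the integrals defining `K_σ` converge
    (∀ n : Fin N → ℤ, MeasureTheory.IntegrableOn
      (fun t : ℝ => t ^ (σ - 1) * DiscreteHeat.heatKernel t n) (Set.Ioi 0)) ∧
    ∃ C : ℝ, 0 < C ∧
      ∀ (f : (Fin N → ℤ) → 𝕜) (hf : Memℓp (DiscreteHeat.sizeMul f) q),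
        -- the sum of `f`, the series `W_t f` and the integrals `(-Δ_N)^{-σ} f` converge
        Summable f ∧
        (∀ t : ℝ, 0 < t → ∀ n : Fin N → ℤ,
          Summable fun k : Fin N → ℤ => (DiscreteHeat.heatKernel t (n - k) : 𝕜) * f k) ∧
        (∀ n : Fin N → ℤ, MeasureTheory.IntegrableOn
          (fun t : ℝ => (t ^ (σ - 1) : ℝ) • DiscreteHeat.heat t f n) (Set.Ioi 0)) ∧
        -- the inequality
        ∃ h : Memℓp (DiscreteHeat.fracDefect σ f) p,
          ‖(⟨DiscreteHeat.fracDefect σ f, h⟩ : lp (fun _ : Fin N → ℤ => 𝕜) p)‖ ≤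
            C * ‖(⟨DiscreteHeat.sizeMul f, hf⟩ : lp (fun _ : Fin N → ℤ => 𝕜) q)‖ := by
  refine ⟨DiscreteHeat.integrableOn_heatKernel hσ hσN, ?_⟩
  have hp : 1 ≤ p := hq.trans hqp
  have hN' : (0 : ℝ) < N := hσ.trans hσN
  have hN : 0 < N := Nat.cast_pos.1 hN'
  have hq1 := DiscreteHeat.mul_one_sub_inv_lt_one hN hq hqN
  have hα : (N : ℝ) * (1 / p).toReal < N * (1 / q).toReal - (2 * σ - 1) := by
    have := mul_lt_mul_of_pos_left hpq hN'
    rwa [mul_sub, mul_div_cancel₀ _ hN'.ne'] at this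
  have hqr : (1 / q).toReal = 1 / q.toReal := by simp
  rw [hqr] at hα
  have hq2 : 1 / q.toReal ≤ 1 := by
    have := DiscreteHeat.one_le_toReal hq hqN.ne_top
    exact (div_le_one (by linarith)).2 this
  -- The lower bound `2σ - N(1 - 1/p)` makes the time integral converge, the upper one is for
  -- Hölder. The interval is nonempty: `hqN` puts the upper bound above `0`, and `hpq` above the
  -- other lower bound.
  obtain ⟨θ, hθl, hθu⟩ := exists_between
    (max_lt (by linarith : (0 : ℝ) < 1 - N * (1 - 1 / q.toReal))
      (by linarith : 2 * σ - N * (1 - (1 / p).toReal) < 1 - N * (1 - 1 / q.toReal)))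
  obtain ⟨hθ, hθσ⟩ := max_lt_iff.1 hθl
  have hθ1 : θ ≤ 1 := by
    have : 0 ≤ (N : ℝ) * (1 - 1 / q.toReal) := mul_nonneg hN'.le (by linarith)
    linarith
  obtain ⟨C₁, hC₁, h₁⟩ := DiscreteHeat.exists_lpLe_fracKernel_sub hσ hσN hp hθ.le hθ1
    (by linarith : σ < θ / 2 + (N : ℝ) / 2 * (1 - (1 / p).toReal))
  obtain ⟨C₂, hC₂, h₂⟩ :=
    DiscreteHeat.exists_tsum_size_rpow_mul_norm_le (𝕜 := 𝕜) hN hq hqN.ne_top hθ hθu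
  -- The summand `1` only makes the constant positive.
  refine ⟨C₁ * C₂ + 1, by positivity, fun f hf => ?_⟩
  obtain ⟨hs, hle⟩ := h₂ f hf
  have hf1 := DiscreteHeat.summable_norm_of_summable_size_rpow hθ.le hs
  refine ⟨hf1.of_norm, fun t ht n => DiscreteHeat.summable_heatKernel_mul ht.le hf1 n,
    DiscreteHeat.integrableOn_heat hσ hσN hf1, ?_⟩
  have hnn := lp.norm_nonneg' (⟨DiscreteHeat.sizeMul f, hf⟩ : lp (fun _ : Fin N → ℤ => 𝕜) q)
  obtain ⟨h, hb⟩ := (DiscreteHeat.LpLe.fracDefect hσ hσN hp hC₁ h₁ hf1 hs).exists_norm_le hp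
    (mul_nonneg hC₁ (tsum_nonneg fun k =>
      mul_nonneg (Real.rpow_nonneg (DiscreteHeat.size_nonneg k) _) (norm_nonneg _)))
  refine ⟨h, hb.trans ?_⟩
  calc _ ≤ C₁ * (C₂ * _) := mul_le_mul_of_nonneg_left hle hC₁
    _ ≤ _ := by
      rw [← mul_assoc]
      exact mul_le_mul_of_nonneg_right (by linarith) hnn
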